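/- Let $N,K,P$ be the numbers of observations, predictors and outcomes. Let $\mathbf Y\in\mathbb R^{N\times P}$ and $\mathbf X\in\mathbb R^{N\times K}$ have rows $\mathbf y_i'$ and $\mathbf x_i'$, and consider the multivariate normal linear model in which the $\mathbf y_i$ are independent, $\mathbf y_i\sim N(\boldsymbol\Theta'\mathbf x_i,\boldsymbol\Sigma)$, with $\boldsymbol\Theta\in\mathbb R^{K\times P}$ and $\boldsymbol\Sigma$ a positive definite $P\times P$ matrix. Write $\boldsymbol\theta=\mathrm{vec}(\boldsymbol\Theta)$, $p(\mathbf Y|\mathbf X,\boldsymbol\Theta,\boldsymbol\Sigma)=\prod_i p(\mathbf y_i|\mathbf x_i,\boldsymbol\Theta,\boldsymbol\Sigma)$ for the likelihood and, for fractions $\mathbf b=(b_1,\dots,b_N)$ with all $b_i>0$, $p(\mathbf Y|\mathbf X,\boldsymbol\Theta,\boldsymbol\Sigma)^{\mathbf b}=\prod_i p(\mathbf y_i|\mathbf x_i,\boldsymbol\Theta,\boldsymbol\Sigma)^{b_i}$. Let $\mathbf Y_{\mathbf b},\mathbf X_{\mathbf b}$ have rows $\sqrt{b_i}\,\mathbf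 y_i'$ and $\sqrt{b_i}\,\mathbf x_i'$, and put $$\hat{\boldsymbol\Theta}=(\mathbf X'\mathbf X)^{-1}\mathbf X'\mathbf Y,\quad \mathbf S=(\mathbf Y-\mathbf X\hat{\boldsymbol\Theta})'(\mathbf Y-\mathbf X\hat{\boldsymbol\Theta}),\quad \hat{\boldsymbol\Theta}_{\mathbf b}=(\mathbf X_{\mathbf b}'\mathbf X_{\mathbf b})^{-1}\mathbf X_{\mathbf b}'\mathbf Y_{\mathbf b},\quad \mathbf S_{\mathbf b}=(\mathbf Y_{\mathbf b}-\mathbf X_{\mathbf b}\hat{\boldsymbol\Theta}_{\mathbf b})'(\mathbf Y_{\mathbf b}-\mathbf X_{\mathbf b}\hat{\boldsymbol\Theta}_{\mathbf b}).$$ Assume that $\mathbf X$ has full column rank, $\mathbf S$ is positive definite and $\sum_i b_i-K-P+1>0$. Let $M_t:\ \mathbf R_E\boldsymbol\theta=\mathbf r_E\ \&\ \mathbf R_O\boldsymbol\theta>\mathbf r_O$ be a constrained model, with $\mathbf R_E$ of full row rank and $\mathcal M_t=\{\boldsymbol\theta:\mathbf R_E\boldsymbol\theta=\mathbf r_E,\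 \mathbf R_O\boldsymbol\theta>\mathbf r_O\}\neq\emptyset$, let $M_u$ be the unconstrained model, and let $\boldsymbol\theta_0=\mathrm{vec}(\boldsymbol\Theta_0)$ satisfy $\mathbf R_E\boldsymbol\theta_0=\mathbf r_E$ and $\mathbf R_O\boldsymbol\theta_0=\mathbf r_O$. Put $\hat{\boldsymbol\theta}_{\mathbf b}=\mathrm{vec}(\hat{\boldsymbol\Theta}_{\mathbf b})$, $\mathcal M_t^*=\{\boldsymbol\theta:\mathbf R_E(\boldsymbol\theta-\hat{\boldsymbol\theta}_{\mathbf b})=\mathbf 0,\ \mathbf R_O(\boldsymbol\theta-\hat{\boldsymbol\theta}_{\mathbf b})>\mathbf 0\}$, and define the default marginal likelihoods $$p_t^*(\mathbf Y,\mathbf b)=\frac{\int_{\boldsymbol\Sigma}\int_{\boldsymbol\Theta\in\mathcal M_t}p(\mathbf Y|\mathbf X,\boldsymbol\Theta,\boldsymbol\Sigma)\,|\boldsymbol\Sigma|^{-\frac{P+1}2}d\boldsymbol\Theta\,d\boldsymbol\Sigma}{\int_{\boldsymbol\Sigma}\int_{\boldsymbol\Theta\in\mathcal M_t^*}p(\mathbf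 Y|\mathbf X,\boldsymbol\Theta,\boldsymbol\Sigma)^{\mathbf b}\,|\boldsymbol\Sigma|^{-\frac{P+1}2}d\boldsymbol\Theta\,d\boldsymbol\Sigma},\qquad p_u(\mathbf Y,\mathbf b)=\frac{\int_{\boldsymbol\Sigma}\int_{\boldsymbol\Theta}p(\mathbf Y|\mathbf X,\boldsymbol\Theta,\boldsymbol\Sigma)\,|\boldsymbol\Sigma|^{-\frac{P+1}2}d\boldsymbol\Theta\,d\boldsymbol\Sigma}{\int_{\boldsymbol\Sigma}\int_{\boldsymbol\Theta}p(\mathbf Y|\mathbf X,\boldsymbol\Theta,\boldsymbol\Sigma)^{\mathbf b}\,|\boldsymbol\Sigma|^{-\frac{P+1}2}d\boldsymbol\Theta\,d\boldsymbol\Sigma},$$ where $d\boldsymbol\Sigma$ is Lebesgue measure on symmetric matrices (restricted to the positive definite ones) and $d\boldsymbol\Theta$ is Lebesgue measure on the affine subspace cut out by the equality constraints. Let $B_{tu}=p_t^*(\mathbf Y,\mathbf b)/p_u(\mathbf Y,\mathbf b)$. Let $\pi_u(\boldsymbol\Theta|\mathbf Y,\mathbf X)$ and $\pi_u(\boldsymbol\Theta|\mathbf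 Y,\mathbf X,\mathbf b)$ be the $\boldsymbol\Theta$-marginals of the probability densities of $(\boldsymbol\Theta,\boldsymbol\Sigma)$ proportional to $p(\mathbf Y|\mathbf X,\boldsymbol\Theta,\boldsymbol\Sigma)|\boldsymbol\Sigma|^{-\frac{P+1}2}$ and $p(\mathbf Y|\mathbf X,\boldsymbol\Theta,\boldsymbol\Sigma)^{\mathbf b}|\boldsymbol\Sigma|^{-\frac{P+1}2}$, and let $\pi_u^*(\boldsymbol\Theta|\mathbf Y,\mathbf X,\mathbf b)=\pi_u(\boldsymbol\Theta+\hat{\boldsymbol\Theta}_{\mathbf b}-\boldsymbol\Theta_0|\mathbf Y,\mathbf X,\mathbf b)$ be the default prior. Let $f_t^E$ and $c_t^E$ be the marginal densities of $\mathbf R_E\boldsymbol\theta$ at $\mathbf r_E$, and $f_t^O$ and $c_t^O$ the conditional probabilities of $\mathbf R_O\boldsymbol\theta>\mathbf r_O$ given $\mathbf R_E\boldsymbol\theta=\mathbf r_E$, under $\pi_u(\cdot|\mathbf Y,\mathbf X)$ and $\pi_u^*(\cdot|\mathbf Y,\mathbf X,\mathbf b)$ respectively. These are computed from the joint density of $(\mathbf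 R_E\boldsymbol\theta,\mathbf D\boldsymbol\theta)$ by integrating out, and conditioning, in the coordinates $\mathbf D\boldsymbol\theta$, where $\mathbf D$ is any matrix that makes $[\mathbf R_E'\ \mathbf D']'$ square and nonsingular. Then all four integrals above are positive and finite, $f_t^E,c_t^E\in(0,\infty)$, $f_t^O,c_t^O\in(0,1]$, and $$B_{tu}=\frac{f_t^E}{c_t^E}\times\frac{f_t^O}{c_t^O}.$$ Moreover, for every $\boldsymbol\Theta$, $$\pi_u(\boldsymbol\Theta|\mathbf Y,\mathbf X)=\mathcal T_{K\times P}\bigl(\hat{\boldsymbol\Theta},(\mathbf X'\mathbf X)^{-1},\mathbf S,N-K-P+1\bigr),\qquad \pi_u^*(\boldsymbol\Theta|\mathbf Y,\mathbf X,\mathbf b)=\mathcal T_{K\times P}\bigl(\boldsymbol\Theta_0,(\mathbf X_{\mathbf b}'\mathbf X_{\mathbf b})^{-1},\mathbf S_{\mathbf b},\textstyle\sum_i b_i-K-P+1\bigr),$$ where $\mathcal T_{K\times P}(\mathbf M,\boldsymbol\Psi,\boldsymbol\Phi,\nu)$ is the matrix $t$ density $$\frac{\Gamma_P\bigl(\frac{\nu+K+P-1}2\bigr)}{\pi^{KP/2}\,\Gamma_P\bigl(\frac{\nu+P-1}2\bigr)}\,|\boldsymbol\Psi|^{-P/2}|\boldsymbol\Phi|^{-K/2}\,\bigl|\mathbf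 I_P+\boldsymbol\Phi^{-1}(\boldsymbol\Theta-\mathbf M)'\boldsymbol\Psi^{-1}(\boldsymbol\Theta-\mathbf M)\bigr|^{-\frac{\nu+K+P-1}2},\qquad \Gamma_P(a)=\pi^{P(P-1)/4}\prod_{j=1}^P\Gamma\bigl(a-\tfrac{j-1}2\bigr).$$ -/

import Mathlib

open MeasureTheory Matrix
open scoped ENNReal

noncomputable section

namespace MVLM

/-! ### Parameters -/

/-- Inverse of `Matrix.vec` (columns stacked): the `K × P` matrix with vectorization `v`. -/
def unvec {K P : ℕ} (v : Fin P × Fin K → ℝ) : Matrix (Fin K) (Fin P) ℝ :=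
  Matrix.of fun k p => v (p, k)

/-- The symmetric `P × P` matrix with free entries `s s(i, j)`. Lebesgue measure on
`Sym2 (Fin P) → ℝ` is the measure `dΣ = ∏_{i ≤ j} dσ_{ij}` on symmetric matrices. -/
def symMatrix {P : ℕ} (s : Sym2 (Fin P) → ℝ) : Matrix (Fin P) (Fin P) ℝ :=
  Matrix.of fun i j => s s(i, j)

/-- Coordinates of the positive definite (covariance) matrices. -/
def posDefCone (P : ℕ) : Set (Sym2 (Fin P) → ℝ) :=
  {s | (symMatrix s).PosDef}

/-! ### Likelihood -/

/-- Density at `y` of the `P`-variate normal distribution `N(m, Σ)`. -/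
def gaussDensity {P : ℕ} (m : Fin P → ℝ) (Sig : Matrix (Fin P) (Fin P) ℝ) (y : Fin P → ℝ) : ℝ :=
  (2 * Real.pi) ^ (-(P : ℝ) / 2) * Sig.det ^ (-(1 : ℝ) / 2) *
    Real.exp (-(1 / 2) * ((y - m) ⬝ᵥ (Sig⁻¹ *ᵥ (y - m))))

/-- Likelihood `p(Y | X, Θ, Σ)`, the rows `yᵢ` of `Y` being independent `N(Θ' xᵢ, Σ)`. -/
def likelihood {N K P : ℕ} (Y : Matrix (Fin N) (Fin P) ℝ) (X : Matrix (Fin N) (Fin K) ℝ)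
    (Th : Matrix (Fin K) (Fin P) ℝ) (Sig : Matrix (Fin P) (Fin P) ℝ) : ℝ :=
  ∏ i, gaussDensity (Thᵀ *ᵥ X i) Sig (Y i)

/-- Generalized fraction of the likelihood, `∏ᵢ p(yᵢ | xᵢ, Θ, Σ) ^ bᵢ`. -/
def fracLikelihood {N K P : ℕ} (b : Fin N → ℝ) (Y : Matrix (Fin N) (Fin P) ℝ)
    (X : Matrix (Fin N) (Fin K) ℝ)
    (Th : Matrix (Fin K) (Fin P) ℝ) (Sig : Matrix (Fin P) (Fin P) ℝ) : ℝ :=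
  ∏ i, gaussDensity (Thᵀ *ᵥ X i) Sig (Y i) ^ b i

/-- Independence Jeffreys prior `|Σ| ^ (-(P+1)/2)`. -/
def jeffreys {P : ℕ} (Sig : Matrix (Fin P) (Fin P) ℝ) : ℝ :=
  Sig.det ^ (-((P : ℝ) + 1) / 2)

/-! ### Least squares quantities -/

/-- `Θ̂ = (X'X)⁻¹ X'Y`. -/
def lsEst {N K P : ℕ} (Y : Matrix (Fin N) (Fin P) ℝ) (X : Matrix (Fin N) (Fin K) ℝ) :
    Matrix (Fin K) (Fin P) ℝ :=
  (Xᵀ * X)⁻¹ * Xᵀ * Y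

/-- `S = (Y - XΘ̂)'(Y - XΘ̂)`. -/
def sumSq {N K P : ℕ} (Y : Matrix (Fin N) (Fin P) ℝ) (X : Matrix (Fin N) (Fin K) ℝ) :
    Matrix (Fin P) (Fin P) ℝ :=
  (Y - X * lsEst Y X)ᵀ * (Y - X * lsEst Y X)

/-- The matrix `A_b` whose `i`-th row is `√bᵢ` times the `i`-th row of `A`. -/
def fracRows {N m : ℕ} (b : Fin N → ℝ) (A : Matrix (Fin N) (Fin m) ℝ) :
    Matrix (Fin N) (Fin m) ℝ :=
  Matrix.of fun i j => Real.sqrt (b i) * A i j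

/-! ### Matrix `t` distribution -/

/-- Multivariate gamma function `Γ_P(a)`. -/
def multiGamma (P : ℕ) (a : ℝ) : ℝ :=
  Real.pi ^ ((P : ℝ) * ((P : ℝ) - 1) / 4) * ∏ j : Fin P, Real.Gamma (a - (j : ℝ) / 2)

/-- Density of the matrix `t` distribution `T_{K×P}(M, Ψ, Φ, ν)` with location `M`, row scale `Ψ`,
column scale `Φ` and `ν` degrees of freedom. -/
def matrixTDensity {K P : ℕ} (M : Matrix (Fin K) (Fin P) ℝ) (Psi : Matrix (Fin K) (Fin K) ℝ)
    (Phi : Matrix (Fin P) (Fin P) ℝ) (nu : ℝ) (Th : Matrix (Fin K) (Fin P) ℝ) : ℝ :=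
  multiGamma P ((nu + K + P - 1) / 2) /
      (Real.pi ^ ((K : ℝ) * P / 2) * multiGamma P ((nu + P - 1) / 2)) *
    Psi.det ^ (-(P : ℝ) / 2) * Phi.det ^ (-(K : ℝ) / 2) *
    (1 + Phi⁻¹ * (Th - M)ᵀ * Psi⁻¹ * (Th - M)).det ^ (-(nu + K + P - 1) / 2)

/-! ### Constrained parameter spaces and marginal likelihoods -/

/-- `{θ | R_E θ = r_E, R_O θ > r_O}`. -/
def constrSet {K P qE qO : ℕ} (RE : Matrix (Fin qE) (Fin P × Fin K) ℝ) (rE : Fin qE → ℝ)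
    (RO : Matrix (Fin qO) (Fin P × Fin K) ℝ) (rO : Fin qO → ℝ) :
    Set (EuclideanSpace ℝ (Fin P × Fin K)) :=
  {θ | RE *ᵥ θ.ofLp = rE ∧ ∀ i, rO i < (RO *ᵥ θ.ofLp) i}

/-- `{θ | R_E (θ - vec C) = 0, R_O (θ - vec C) > 0}`. -/
def adjConstrSet {K P qE qO : ℕ} (RE : Matrix (Fin qE) (Fin P × Fin K) ℝ)
    (RO : Matrix (Fin qO) (Fin P × Fin K) ℝ) (C : Matrix (Fin K) (Fin P) ℝ) :
    Set (EuclideanSpace ℝ (Fin P × Fin K)) :=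
  {θ | RE *ᵥ (θ.ofLp - C.vec) = 0 ∧ ∀ i, 0 < (RO *ᵥ (θ.ofLp - C.vec)) i}

/-- `∫_Σ ∫_{Θ ∈ M} L(Θ, Σ) |Σ| ^ (-(P+1)/2) dΘ dΣ`, where `M` is a subset of a `d`-dimensional
affine subspace and `dΘ` is `d`-dimensional Lebesgue measure on that subspace. -/
def evidence {K P : ℕ} (d : ℕ) (M : Set (EuclideanSpace ℝ (Fin P × Fin K)))
    (L : Matrix (Fin K) (Fin P) ℝ → Matrix (Fin P) (Fin P) ℝ → ℝ) : ℝ≥0∞ :=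
  ∫⁻ s in posDefCone P, ∫⁻ θ in M,
    ENNReal.ofReal (L (unvec θ.ofLp) (symMatrix s) * jeffreys (symMatrix s))
      ∂(Measure.euclideanHausdorffMeasure d)

/-- Default marginal likelihood `p*_t(Y, b)` under the constrained model. The numerator integrates
the likelihood over the constrained space; the denominator integrates the fractional likelihood
over the constrained space moved so that its boundary passes through the least squares estimate
of that fractional likelihood. -/
def constrMargLik {N K P qE qO : ℕ} (Y : Matrix (Fin N) (Fin P) ℝ)
    (X : Matrix (Fin N) (Fin K) ℝ) (b : Fin N → ℝ)
    (RE : Matrix (Fin qE) (Fin P × Fin K) ℝ) (rE : Fin qE → ℝ)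
    (RO : Matrix (Fin qO) (Fin P × Fin K) ℝ) (rO : Fin qO → ℝ) : ℝ≥0∞ :=
  evidence (P * K - qE) (constrSet RE rE RO rO) (likelihood Y X) /
    evidence (P * K - qE) (adjConstrSet RE RO (lsEst (fracRows b Y) (fracRows b X)))
      (fracLikelihood b Y X)

/-- Marginal likelihood `p_u(Y, b)` under the unconstrained model. -/
def uncMargLik {N K P : ℕ} (Y : Matrix (Fin N) (Fin P) ℝ)
    (X : Matrix (Fin N) (Fin K) ℝ) (b : Fin N → ℝ) : ℝ≥0∞ :=
  evidence (P * K) Set.univ (likelihood Y X) / evidence (P * K) Set.univ (fracLikelihood b Y X)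

/-- Default Bayes factor `B_tu`. -/
def bayesFactor {N K P qE qO : ℕ} (Y : Matrix (Fin N) (Fin P) ℝ)
    (X : Matrix (Fin N) (Fin K) ℝ) (b : Fin N → ℝ)
    (RE : Matrix (Fin qE) (Fin P × Fin K) ℝ) (rE : Fin qE → ℝ)
    (RO : Matrix (Fin qO) (Fin P × Fin K) ℝ) (rO : Fin qO → ℝ) : ℝ≥0∞ :=
  constrMargLik Y X b RE rE RO rO / uncMargLik Y X b

/-! ### Unconstrained posterior and default prior of `Θ` -/

/-- Marginal density of `Θ` when the joint density of `(Θ, Σ)` is proportional to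
`L(Θ, Σ) |Σ| ^ (-(P+1)/2)`. -/
def thetaDensity {K P : ℕ} (L : Matrix (Fin K) (Fin P) ℝ → Matrix (Fin P) (Fin P) ℝ → ℝ)
    (Th : Matrix (Fin K) (Fin P) ℝ) : ℝ≥0∞ :=
  ∫⁻ s in posDefCone P,
    ENNReal.ofReal (L Th (symMatrix s) * jeffreys (symMatrix s)) / evidence (P * K) Set.univ L

/-- Unconstrained marginal posterior `π_u(Θ | Y, X)`. -/
def posterior {N K P : ℕ} (Y : Matrix (Fin N) (Fin P) ℝ) (X : Matrix (Fin N) (Fin K) ℝ) :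
    Matrix (Fin K) (Fin P) ℝ → ℝ≥0∞ :=
  thetaDensity (likelihood Y X)

/-- Default prior `π*_u(Θ | Y, X, b)`: the fractional prior `π_u(Θ | Y, X, b)` translated so that
its location moves from the least squares estimate to `Θ₀`. -/
def defaultPrior {N K P : ℕ} (Y : Matrix (Fin N) (Fin P) ℝ) (X : Matrix (Fin N) (Fin K) ℝ)
    (b : Fin N → ℝ) (Th0 : Matrix (Fin K) (Fin P) ℝ) :
    Matrix (Fin K) (Fin P) ℝ → ℝ≥0∞ :=
  fun Th => thetaDensity (fracLikelihood b Y X)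
    (Th + lsEst (fracRows b Y) (fracRows b X) - Th0)

/-! ### Marginal and conditional distributions in the coordinates `ζ = (R_E θ, D θ)` -/

/-- The square matrix `H = [R_E' D']'`, its rows listed in the order given by `e`. -/
def coordMatrix {K P qE d : ℕ} (RE : Matrix (Fin qE) (Fin P × Fin K) ℝ)
    (D : Matrix (Fin d) (Fin P × Fin K) ℝ) (e : Fin qE ⊕ Fin d ≃ Fin P × Fin K) :
    Matrix (Fin P × Fin K) (Fin P × Fin K) ℝ :=
  (Matrix.fromRows RE D).submatrix e.symm id

/-- `θ = H⁻¹ ζ` for `ζ = (ζ_E, ζ_O)`. -/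
def thetaOf {K P qE d : ℕ} (RE : Matrix (Fin qE) (Fin P × Fin K) ℝ)
    (D : Matrix (Fin d) (Fin P × Fin K) ℝ) (e : Fin qE ⊕ Fin d ≃ Fin P × Fin K)
    (zE : Fin qE → ℝ) (zO : Fin d → ℝ) : Fin P × Fin K → ℝ :=
  (coordMatrix RE D e)⁻¹ *ᵥ (Sum.elim zE zO ∘ e.symm)

/-- Joint density of `(ζ_E, ζ_O) = Hθ` when `Θ` has density `π`. -/
def zetaDensity {K P qE d : ℕ} (RE : Matrix (Fin qE) (Fin P × Fin K) ℝ)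
    (D : Matrix (Fin d) (Fin P × Fin K) ℝ) (e : Fin qE ⊕ Fin d ≃ Fin P × Fin K)
    (π : Matrix (Fin K) (Fin P) ℝ → ℝ≥0∞) (zE : Fin qE → ℝ) (zO : Fin d → ℝ) : ℝ≥0∞ :=
  ENNReal.ofReal (|(coordMatrix RE D e).det|⁻¹) * π (unvec (thetaOf RE D e zE zO))

/-- Marginal density of `ζ_E = R_E θ` at `zE`. -/
def margDensity {K P qE d : ℕ} (RE : Matrix (Fin qE) (Fin P × Fin K) ℝ)
    (D : Matrix (Fin d) (Fin P × Fin K) ℝ) (e : Fin qE ⊕ Fin d ≃ Fin P × Fin K)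
    (π : Matrix (Fin K) (Fin P) ℝ → ℝ≥0∞) (zE : Fin qE → ℝ) : ℝ≥0∞ :=
  ∫⁻ zO, zetaDensity RE D e π zE zO

/-- Conditional probability of `R_O θ > r_O` given `R_E θ = zE`, the conditional density of `ζ_O`
being the ratio of joint to marginal density. -/
def condProb {K P qE qO d : ℕ} (RE : Matrix (Fin qE) (Fin P × Fin K) ℝ)
    (D : Matrix (Fin d) (Fin P × Fin K) ℝ) (e : Fin qE ⊕ Fin d ≃ Fin P × Fin K)
    (RO : Matrix (Fin qO) (Fin P × Fin K) ℝ) (rO : Fin qO → ℝ)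
    (π : Matrix (Fin K) (Fin P) ℝ → ℝ≥0∞) (zE : Fin qE → ℝ) : ℝ≥0∞ :=
  ∫⁻ zO in {zO | ∀ i, rO i < (RO *ᵥ thetaOf RE D e zE zO) i},
    zetaDensity RE D e π zE zO / margDensity RE D e π zE

end MVLM

end

/-! Seen as functions of `(Θ, Σ)`, the likelihood and the fractional likelihood times the Jeffreys
prior are both normal–inverse Wishart kernels with location the corresponding least squares
estimate: the residual sum of squares is quadratic in `Θ` around that estimate. For such a kernel
the `Σ`-integral is inverse Wishart and the remaining function of `Θ` is a matrix `t` density; the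
inverse Wishart integral follows by induction on `P`, splitting off one row and column of `Σ` by a
Schur complement.

The integral of the kernel over a constrained space is the unconstrained integral times
`f^E · f^O`, times a Jacobian that depends on `R_E` and `D` only, hence cancels in the Bayes
factor. Translating `Θ` by `Θ̂_b - Θ₀` carries the default prior to the fractional posterior and the
constraints to those of the adjusted space `M_t^*`. -/

noncomputable section

namespace MVLM

/-! ### Gaussian and inverse gamma integrals -/

lemma lintegral_comp_mulVec {ι : Type*} [Fintype ι] [DecidableEq ι] {M : Matrix ι ι ℝ}
    (hM : M.det ≠ 0) (f : (ι → ℝ) → ℝ≥0∞) :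
    ∫⁻ x, f x = ENNReal.ofReal |M.det| * ∫⁻ u, f (M *ᵥ u) := by
  have hemb : MeasurableEmbedding (toLin' M) :=
    (Matrix.toLinearEquiv' M (M.invertibleOfIsUnitDet hM.isUnit)).toContinuousLinearEquiv
      |>.toHomeomorph.measurableEmbedding
  have hmap : ∫⁻ u, f (M *ᵥ u) = ENNReal.ofReal |M.det⁻¹| * ∫⁻ x, f x := by
    rw [← smul_eq_mul, ← lintegral_smul_measure, ← Real.map_matrix_volume_pi_eq_smul_volume_pi hM,
      hemb.lintegral_map]
    rfl
  rw [hmap, ← mul_assoc, ← ENNReal.ofReal_mul (abs_nonneg _), ← abs_mul, mul_inv_cancel₀ hM]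
  simp

lemma lintegral_exp_neg_dotProduct_self (ι : Type*) [Fintype ι] :
    ∫⁻ u : ι → ℝ, ENNReal.ofReal (Real.exp (-(u ⬝ᵥ u))) =
      ENNReal.ofReal (Real.pi ^ ((Fintype.card ι : ℝ) / 2)) := by
  have hprod (u : ι → ℝ) : Real.exp (-(u ⬝ᵥ u)) = ∏ i, Real.exp (-1 * u i ^ 2) := by
    rw [← Real.exp_sum]
    simp [dotProduct, pow_two]
  simp_rw [hprod]
  rw [← ofReal_integral_eq_lintegral_ofReal
    (by exact Integrable.fintype_prod fun _ => integrable_exp_neg_mul_sq one_pos)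
    (.of_forall fun u => Finset.prod_nonneg fun i _ => (Real.exp_pos _).le),
    integral_fintype_prod_volume_eq_pow (fun x : ℝ => Real.exp (-1 * x ^ 2)), integral_gaussian,
    div_one, Real.sqrt_eq_rpow, ← Real.rpow_mul_natCast Real.pi_pos.le]
  congr 2
  ring

open scoped MatrixOrder in
lemma lintegral_exp_neg_quadratic {ι : Type*} [Fintype ι] [DecidableEq ι] {M : Matrix ι ι ℝ}
    (hM : M.PosDef) (m : ι → ℝ) :
    ∫⁻ u, ENNReal.ofReal (Real.exp (-((u - m) ⬝ᵥ (M *ᵥ (u - m))))) =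
      ENNReal.ofReal (Real.pi ^ ((Fintype.card ι : ℝ) / 2) * M.det ^ (-(1 : ℝ) / 2)) := by
  rw [lintegral_sub_right_eq_self
    (fun u : ι → ℝ => ENNReal.ofReal (Real.exp (-(u ⬝ᵥ (M *ᵥ u))))) m]
  obtain ⟨C, rfl⟩ := CStarAlgebra.nonneg_iff_eq_star_mul_self.mp hM.posSemidef.nonneg
  rw [star_eq_conjTranspose, conjTranspose_eq_transpose_of_trivial] at *
  have hC : C.det ≠ 0 := fun h => by simpa [h] using hM.det_pos
  have hdet : (Cᵀ * C).det ^ (-(1 : ℝ) / 2) = |C.det|⁻¹ := by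
    rw [det_mul, det_transpose, ← abs_mul_abs_self, ← pow_two,
      ← Real.rpow_natCast_mul (abs_nonneg _)]
    norm_num [Real.rpow_neg_one]
  have hlen (u : ι → ℝ) : u ⬝ᵥ ((Cᵀ * C) *ᵥ u) = (C *ᵥ u) ⬝ᵥ (C *ᵥ u) := by
    rw [← mulVec_mulVec, dotProduct_mulVec, vecMul_transpose]
  have hcov := lintegral_comp_mulVec hC fun u : ι → ℝ => ENNReal.ofReal (Real.exp (-(u ⬝ᵥ u)))
  simp_rw [hlen]
  rw [hdet, ENNReal.ofReal_mul (by positivity), ← lintegral_exp_neg_dotProduct_self, hcov,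
    mul_comm, ← mul_assoc, ← ENNReal.ofReal_mul (by positivity),
    inv_mul_cancel₀ (abs_ne_zero.mpr hC), ENNReal.ofReal_one, one_mul]

lemma lintegral_rpow_mul_exp_neg_div {a δ : ℝ} (ha : 0 < a) (hδ : 0 < δ) :
    ∫⁻ t in Set.Ioi (0 : ℝ), ENNReal.ofReal (t ^ (-a - 1) * Real.exp (-(δ / t))) =
      ENNReal.ofReal (Real.Gamma a * δ ^ (-a)) := by
  have hne : (-1 : ℝ) ≠ 0 := by norm_num
  set g : ℝ → ℝ := fun t => t ^ (a - 1) * Real.exp (-(δ * t)) with hg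
  have hgamma : ∫ t in Set.Ioi 0, g t = (1 / δ) ^ a * Real.Gamma a :=
    Real.integral_rpow_mul_exp_neg_mul_Ioi ha hδ
  have hint : IntegrableOn g (Set.Ioi 0) := by
    refine Integrable.of_integral_ne_zero ?_
    have := Real.Gamma_pos_of_pos ha
    rw [hgamma]
    positivity
  have hinv : ∀ t ∈ Set.Ioi (0 : ℝ), t ^ (-a - 1) * Real.exp (-(δ / t)) =
      (|(-1 : ℝ)| * t ^ ((-1 : ℝ) - 1)) • g (t ^ (-1 : ℝ)) := by
    intro t (ht : 0 < t)
    simp only [hg, smul_eq_mul, abs_neg, abs_one, one_mul]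
    rw [← Real.rpow_mul ht.le, ← mul_assoc, ← Real.rpow_add ht, Real.rpow_neg_one, div_eq_mul_inv]
    congr 2
    ring
  rw [setLIntegral_congr_fun measurableSet_Ioi (fun t ht => by rw [hinv t ht]),
    ← ofReal_integral_eq_lintegral_ofReal ((integrableOn_Ioi_comp_rpow_iff g hne).mpr hint),
    integral_comp_rpow_Ioi g hne, hgamma, one_div, Real.inv_rpow hδ.le, Real.rpow_neg hδ.le,
    mul_comm]
  filter_upwards [self_mem_ae_restrict measurableSet_Ioi] with t (ht : 0 < t)
  simp only [hg, smul_eq_mul, Pi.zero_apply]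
  positivity

lemma measurePreserving_sumElim_comp_symm {ι κ τ : Type*} [Fintype ι] [Fintype κ] [Fintype τ]
    (e : ι ⊕ κ ≃ τ) :
    MeasurePreserving fun p : (ι → ℝ) × (κ → ℝ) => Sum.elim p.1 p.2 ∘ e.symm := by
  have h := (volume_measurePreserving_piCongrLeft (fun _ => ℝ) e).comp
    (volume_measurePreserving_sumPiEquivProdPi_symm fun _ : ι ⊕ κ => ℝ)
  convert! h using 1
  ext p j
  obtain ⟨i, rfl⟩ := e.surjective j
  rw [Function.comp_apply, Function.comp_apply, MeasurableEquiv.coe_piCongrLeft,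
    Equiv.piCongrLeft_apply_apply, e.symm_apply_apply]
  rcases i with i | i <;> rfl

lemma lintegral_eq_lintegral_sumElim {ι κ τ : Type*} [Fintype ι] [Fintype κ] [Fintype τ]
    (e : ι ⊕ κ ≃ τ) {f : (τ → ℝ) → ℝ≥0∞} (hf : Measurable f) :
    ∫⁻ x, f x = ∫⁻ y, ∫⁻ z, f (Sum.elim y z ∘ e.symm) := by
  have he := measurePreserving_sumElim_comp_symm e
  rw [← he.lintegral_comp hf, Measure.volume_eq_prod]
  exact lintegral_prod _ (hf.comp he.measurable).aemeasurable

/-! ### Schur complements -/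

lemma transpose_eq_of_posDef {m : Type*} {A : Matrix m m ℝ} (hA : A.PosDef) : Aᵀ = A := by
  simpa [conjTranspose_eq_transpose_of_trivial] using hA.isHermitian.eq

section SchurBlock

variable {m n : Type*} [Fintype m]

/-- The symmetric block matrix with leading block `B` and Schur complement `T`, whose upper right
block is `B * U`. In these coordinates the determinant and the inverse factor through `B` and
`T`. -/
def schurBlock (B : Matrix m m ℝ) (U : Matrix m n ℝ) (T : Matrix n n ℝ) :
    Matrix (m ⊕ n) (m ⊕ n) ℝ :=
  fromBlocks B (B * U) (Uᵀ * B) (T + Uᵀ * B * U)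

variable [DecidableEq m] [Fintype n] [DecidableEq n]

lemma schurBlock_add (A : Matrix m m ℝ) (U V : Matrix m n ℝ) (T : Matrix n n ℝ) :
    schurBlock A (U + V) T =
      fromBlocks 1 0 Uᵀ 1 * schurBlock A V T * (fromBlocks 1 0 Uᵀ 1)ᵀ := by
  simp only [schurBlock, fromBlocks_transpose, fromBlocks_multiply, transpose_one, transpose_zero,
    transpose_transpose, transpose_add, Matrix.one_mul, Matrix.mul_one, Matrix.zero_mul,
    Matrix.mul_zero, Matrix.add_mul, Matrix.mul_add, Matrix.mul_assoc, add_zero]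
  congr 1
  abel

lemma schurBlock_eq_conj (A : Matrix m m ℝ) (U : Matrix m n ℝ) (T : Matrix n n ℝ) :
    schurBlock A U T =
      fromBlocks 1 0 Uᵀ 1 * fromBlocks A 0 0 T * (fromBlocks 1 0 Uᵀ 1)ᵀ := by
  rw [← add_zero U, schurBlock_add, add_zero]
  simp [schurBlock]

lemma det_schurBlock (B : Matrix m m ℝ) (U : Matrix m n ℝ) (T : Matrix n n ℝ) :
    (schurBlock B U T).det = B.det * T.det := by
  rw [schurBlock_eq_conj, det_mul, det_mul, det_transpose]
  simp

lemma trace_inv_schurBlock_mul {B : Matrix m m ℝ} {T : Matrix n n ℝ} (hB : IsUnit B.det)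
    (hT : IsUnit T.det)
    (A : Matrix m m ℝ) (D : Matrix n n ℝ) (U M : Matrix m n ℝ) :
    ((schurBlock B U T)⁻¹ * schurBlock A M D).trace =
      (B⁻¹ * A).trace + (T⁻¹ * (D + (M - U)ᵀ * A * (M - U))).trace := by
  have hB' : Invertible B := B.invertibleOfIsUnitDet hB
  have hT' : Invertible T := T.invertibleOfIsUnitDet hT
  set L : Matrix (m ⊕ n) (m ⊕ n) ℝ := fromBlocks 1 0 Uᵀ 1 with hL
  have hLdet : IsUnit L.det := by simp [L]
  have hdiag : (fromBlocks B 0 0 T)⁻¹ = fromBlocks B⁻¹ 0 0 T⁻¹ :=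
    inv_eq_right_inv (by simp [fromBlocks_multiply])
  have hM : schurBlock A M D = L * schurBlock A (M - U) D * Lᵀ := by
    rw [← schurBlock_add, add_sub_cancel]
  rw [schurBlock_eq_conj, ← hL, hM, Matrix.mul_inv_rev,
    Matrix.mul_inv_rev, hdiag, Matrix.mul_assoc, Matrix.mul_assoc, Matrix.mul_assoc L,
    nonsing_inv_mul_cancel_left _ _ hLdet, trace_mul_comm, Matrix.mul_assoc, Matrix.mul_assoc,
    mul_nonsing_inv _ (by rwa [det_transpose]), Matrix.mul_one, schurBlock, fromBlocks_multiply]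
  simp [trace]

end SchurBlock

lemma posDef_schurBlock_iff {m n : Type*} [Fintype m] [Finite n]
    {B : Matrix m m ℝ} {U : Matrix m n ℝ} {T : Matrix n n ℝ} :
    (schurBlock B U T).PosDef ↔ B.PosDef ∧ T.PosDef := by
  classical
  have := Fintype.ofFinite n
  have hdet := det_schurBlock B U T
  have hpsd (hB : B.PosDef) : (schurBlock B U T).PosSemidef ↔ T.PosSemidef := by
    have : Invertible B := hB.isUnit.invertible
    have h := PosDef.fromBlocks₁₁ (B * U) (T + Uᵀ * B * U) hB
    rwa [conjTranspose_eq_transpose_of_trivial, transpose_mul, transpose_eq_of_posDef hB,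
      Matrix.mul_assoc (Uᵀ * B), Matrix.inv_mul_cancel_left_of_invertible, Matrix.mul_assoc,
      add_sub_cancel_right, ← Matrix.mul_assoc] at h
  constructor
  · intro h
    have hB : B.PosDef := h.submatrix (e := Sum.inl) Sum.inl_injective
    exact ⟨hB, ((hpsd hB).mp h.posSemidef).posDef_iff_det_ne_zero.mpr
      (right_ne_zero_of_mul (hdet ▸ h.det_pos.ne'))⟩
  · rintro ⟨hB, hT⟩
    exact ((hpsd hB).mpr hT.posSemidef).posDef_iff_det_ne_zero.mpr
      (hdet ▸ (mul_pos hB.det_pos hT.det_pos).ne')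

/-! ### Lebesgue measure on the positive definite cone in Schur coordinates -/

section PosDefCone

variable {P : ℕ}

lemma transpose_symMatrix (s : Sym2 (Fin P) → ℝ) : (symMatrix s)ᵀ = symMatrix s := by
  ext i j
  simp [symMatrix, Sym2.eq_swap]

lemma isHermitian_symMatrix (s : Sym2 (Fin P) → ℝ) : (symMatrix s).IsHermitian := by
  rw [IsHermitian, conjTranspose_eq_transpose_of_trivial, transpose_symMatrix]

lemma exists_symMatrix_eq {A : Matrix (Fin P) (Fin P) ℝ} (hA : Aᵀ = A) : ∃ s, symMatrix s = A :=
  ⟨Sym2.lift ⟨fun i j => A i j, fun i j => congrFun₂ hA.symm i j⟩, rfl⟩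

lemma continuous_symMatrix :
    Continuous (symMatrix : (Sym2 (Fin P) → ℝ) → Matrix (Fin P) (Fin P) ℝ) :=
  continuous_matrix fun i j => continuous_apply s(i, j)

lemma measurable_det_symMatrix : Measurable fun s : Sym2 (Fin P) → ℝ => (symMatrix s).det :=
  continuous_symMatrix.matrix_det.measurable

lemma measurableSet_posDefCone (P : ℕ) : MeasurableSet (posDefCone P) := by
  have hcone : posDefCone P =
      (⋂ x : Fin P → ℝ, {s | 0 ≤ x ⬝ᵥ (symMatrix s *ᵥ x)}) ∩ {s | (symMatrix s).det ≠ 0} := by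
    ext s
    simp only [posDefCone, Set.mem_ofPred_eq, Set.mem_inter_iff, Set.mem_iInter]
    constructor
    · intro hs
      exact ⟨fun x => by simpa using hs.posSemidef.dotProduct_mulVec_nonneg x, hs.det_pos.ne'⟩
    · rintro ⟨hnonneg, hdet⟩
      exact (PosSemidef.of_dotProduct_mulVec_nonneg (isHermitian_symMatrix s)
        fun x => by simpa using hnonneg x).posDef_iff_det_ne_zero.mpr hdet
  rw [hcone]
  refine (isClosed_iInter fun x => ?_).measurableSet.inter ?_
  · exact isClosed_le continuous_const
      (continuous_const.dotProduct (continuous_symMatrix.matrix_mulVec continuous_const))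
  · exact (isOpen_ne_fun continuous_symMatrix.matrix_det continuous_const).measurableSet

/-- The unordered pairs in `Fin (P + 1)`: those in `Fin P`, the pairs `{i, P}` with `i < P`, and
`{P, P}`. -/
def sym2Succ (P : ℕ) : Sym2 (Fin P) ⊕ (Fin P ⊕ Unit) → Sym2 (Fin (P + 1)) :=
  Sum.elim (Sym2.map Fin.castSucc)
    (Sum.elim (fun i => s(i.castSucc, Fin.last P)) fun _ => s(Fin.last P, Fin.last P))

lemma bijective_sym2Succ (P : ℕ) : Function.Bijective (sym2Succ P) := by
  refine (Fintype.bijective_iff_surjective_and_card _).mpr ⟨fun z => ?_, ?_⟩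
  · induction z with | _ a b =>
    induction a using Fin.lastCases with
    | last =>
      induction b using Fin.lastCases with
      | last => exact ⟨Sum.inr (Sum.inr ()), rfl⟩
      | cast j => exact ⟨Sum.inr (Sum.inl j), Sym2.eq_swap⟩
    | cast i =>
      induction b using Fin.lastCases with
      | last => exact ⟨Sum.inr (Sum.inl i), rfl⟩
      | cast j => exact ⟨Sum.inl s(i, j), rfl⟩
  · simp [Sym2.card, Nat.choose_succ_succ']
    omega

/-- `sym2Succ` as an equivalence, which splits the coordinates of a symmetric matrix into those of
its leading block, its last column and its last diagonal entry. -/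
def sym2SuccEquiv (P : ℕ) : Sym2 (Fin P) ⊕ (Fin P ⊕ Unit) ≃ Sym2 (Fin (P + 1)) :=
  Equiv.ofBijective _ (bijective_sym2Succ P)

/-- Coordinates of the symmetric matrix with leading block `s`, last column `v` and last diagonal
entry `c`. -/
def borderCoords (s : Sym2 (Fin P) → ℝ) (v : Fin P → ℝ) (c : ℝ) : Sym2 (Fin (P + 1)) → ℝ :=
  Sum.elim s (Sum.elim v fun _ => c) ∘ (sym2SuccEquiv P).symm

lemma borderCoords_sym2Succ (s : Sym2 (Fin P) → ℝ) (v : Fin P → ℝ) (c : ℝ)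
    (z : Sym2 (Fin P) ⊕ (Fin P ⊕ Unit)) :
    borderCoords s v c (sym2Succ P z) = Sum.elim s (Sum.elim v fun _ => c) z :=
  congrArg _ ((sym2SuccEquiv P).symm_apply_apply z)

lemma lintegral_sym2_succ {f : (Sym2 (Fin (P + 1)) → ℝ) → ℝ≥0∞} (hf : Measurable f) :
    ∫⁻ x, f x = ∫⁻ s, ∫⁻ v, ∫⁻ c, f (borderCoords s v c) := by
  rw [lintegral_eq_lintegral_sumElim (sym2SuccEquiv P) hf]
  refine lintegral_congr fun s => ?_
  have hfs : Measurable fun y => f (Sum.elim s y ∘ (sym2SuccEquiv P).symm) :=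
    hf.comp ((measurePreserving_sumElim_comp_symm (sym2SuccEquiv P)).measurable.comp
      measurable_prodMk_left)
  rw [lintegral_eq_lintegral_sumElim (Equiv.refl (Fin P ⊕ Unit)) hfs]
  refine lintegral_congr fun v => ?_
  rw [← (volume_preserving_funUnique Unit ℝ).symm.lintegral_comp]
  · rfl
  · exact hfs.comp ((measurePreserving_sumElim_comp_symm (Equiv.refl _)).measurable.comp
      measurable_prodMk_left)

/-- Coordinates of the symmetric matrix with leading block `S = symMatrix s`, last column `S u` and
Schur complement `t`. -/
def schurCoords (s : Sym2 (Fin P) → ℝ) (u : Fin P → ℝ) (t : ℝ) : Sym2 (Fin (P + 1)) → ℝ :=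
  borderCoords s (symMatrix s *ᵥ u) (t + u ⬝ᵥ (symMatrix s *ᵥ u))

lemma symMatrix_schurCoords (s : Sym2 (Fin P) → ℝ) (u : Fin P → ℝ) (t : ℝ) :
    (symMatrix (schurCoords s u t)).submatrix finSumFinEquiv finSumFinEquiv =
      schurBlock (symMatrix s) (replicateCol (Fin 1) u) (diagonal fun _ => t) := by
  have hcol : symMatrix s * replicateCol (Fin 1) u =
      replicateCol (Fin 1) (symMatrix s *ᵥ u) := (replicateCol_mulVec ..).symm
  have hrow : (replicateCol (Fin 1) u)ᵀ * symMatrix s =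
      replicateRow (Fin 1) (symMatrix s *ᵥ u) := by
    rw [← transpose_inj, transpose_mul, transpose_symMatrix, transpose_transpose, hcol,
      transpose_replicateRow]
  have key := borderCoords_sym2Succ s (symMatrix s *ᵥ u) (t + u ⬝ᵥ (symMatrix s *ᵥ u))
  rw [schurBlock, Matrix.mul_assoc, hcol, hrow]
  ext (i | i) (j | j)
  · exact key (Sum.inl s(i, j))
  · rw [Subsingleton.elim j 0]
    exact key (Sum.inr (Sum.inl i))
  · rw [Subsingleton.elim i 0]
    exact (congrArg (schurCoords s u t) Sym2.eq_swap).trans (key (Sum.inr (Sum.inl j)))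
  · rw [Subsingleton.elim i 0, Subsingleton.elim j 0]
    exact (key (Sum.inr (Sum.inr ()))).trans (by simp [mul_apply, dotProduct])

lemma posDef_submatrix_equiv {m n : Type*} (e : m ≃ n) {A : Matrix n n ℝ} :
    (A.submatrix e e).PosDef ↔ A.PosDef :=
  ⟨fun h => by simpa using h.submatrix e.symm.injective, fun h => h.submatrix e.injective⟩

lemma schurCoords_mem_posDefCone {s : Sym2 (Fin P) → ℝ} {u : Fin P → ℝ} {t : ℝ} :
    schurCoords s u t ∈ posDefCone (P + 1) ↔ s ∈ posDefCone P ∧ 0 < t := by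
  rw [posDefCone, Set.mem_ofPred_eq, ← posDef_submatrix_equiv finSumFinEquiv,
    symMatrix_schurCoords, posDef_schurBlock_iff, posDef_diagonal_iff]
  simp [posDefCone]

lemma exists_schurCoords_eq {x : Sym2 (Fin (P + 1)) → ℝ} (hx : x ∈ posDefCone (P + 1)) :
    ∃ s u t, schurCoords s u t = x := by
  set s : Sym2 (Fin P) → ℝ := x ∘ Sym2.map Fin.castSucc
  set v : Fin P → ℝ := fun i => x s(i.castSucc, Fin.last P)
  have hS : (symMatrix s).PosDef := hx.submatrix (Fin.castSucc_injective P)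
  have hu : symMatrix s *ᵥ ((symMatrix s)⁻¹ *ᵥ v) = v := by
    rw [mulVec_mulVec, mul_nonsing_inv _ hS.det_pos.ne'.isUnit, one_mulVec]
  refine ⟨s, (symMatrix s)⁻¹ *ᵥ v,
    x s(Fin.last P, Fin.last P) - ((symMatrix s)⁻¹ *ᵥ v) ⬝ᵥ v, ?_⟩
  ext z
  obtain ⟨y, rfl⟩ := (bijective_sym2Succ P).surjective z
  rw [schurCoords, hu, sub_add_cancel, borderCoords_sym2Succ]
  rcases y with y | y | y <;> rfl

lemma det_symMatrix_schurCoords (s : Sym2 (Fin P) → ℝ) (u : Fin P → ℝ) (t : ℝ) :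
    (symMatrix (schurCoords s u t)).det = (symMatrix s).det * t := by
  rw [← det_submatrix_equiv_self finSumFinEquiv, symMatrix_schurCoords, det_schurBlock,
    det_diagonal]
  simp

lemma trace_submatrix_equiv {m n R : Type*} [Fintype m] [Fintype n] [AddCommMonoid R] (e : m ≃ n)
    (A : Matrix n n R) : (A.submatrix e e).trace = A.trace :=
  e.sum_comp fun i => A i i

lemma trace_inv_symMatrix_schurCoords_mul {s : Sym2 (Fin P) → ℝ} (hs : s ∈ posDefCone P)
    {t : ℝ} (ht : 0 < t) (u : Fin P → ℝ) (r : Sym2 (Fin P) → ℝ) (m : Fin P → ℝ) (δ : ℝ) :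
    ((symMatrix (schurCoords s u t))⁻¹ * symMatrix (schurCoords r m δ)).trace =
      ((symMatrix s)⁻¹ * symMatrix r).trace +
        (δ + (u - m) ⬝ᵥ (symMatrix r *ᵥ (u - m))) / t := by
  have hsub : replicateCol (Fin 1) m - replicateCol (Fin 1) u =
      -replicateCol (Fin 1) (u - m) := by
    ext
    simp
  have hinv : (diagonal fun _ : Fin 1 => t)⁻¹ = diagonal fun _ : Fin 1 => t⁻¹ :=
    inv_eq_right_inv (by simp [ht.ne'])
  rw [← trace_submatrix_equiv finSumFinEquiv, ← submatrix_mul_equiv _ _ _ finSumFinEquiv,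
    ← inv_submatrix_equiv, symMatrix_schurCoords, symMatrix_schurCoords,
    trace_inv_schurBlock_mul (PosDef.det_pos hs).ne'.isUnit (by simp [ht.ne']), hsub, hinv,
    add_right_inj, transpose_neg, Matrix.neg_mul, Matrix.neg_mul, Matrix.mul_neg, neg_neg,
    Matrix.mul_assoc, ← replicateCol_mulVec, transpose_replicateCol]
  simp [trace, mul_apply, dotProduct, div_eq_inv_mul]

@[fun_prop]
lemma measurable_schurCoords (s : Sym2 (Fin P) → ℝ) :
    Measurable fun p : (Fin P → ℝ) × ℝ => schurCoords s p.1 p.2 := by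
  refine measurable_pi_iff.mpr fun z => ?_
  obtain ⟨y, rfl⟩ := (bijective_sym2Succ P).surjective z
  simp_rw [schurCoords, borderCoords_sym2Succ]
  rcases y with y | y | y
  · exact measurable_const
  · exact Continuous.measurable (by
      simp only [Sum.elim_inr, Sum.elim_inl, mulVec, dotProduct]; fun_prop)
  · exact Continuous.measurable (by
      simp only [Sum.elim_inr, mulVec, dotProduct]; fun_prop)

lemma lintegral_borderCoords {s : Sym2 (Fin P) → ℝ} (hs : s ∈ posDefCone P)
    {f : (Sym2 (Fin (P + 1)) → ℝ) → ℝ≥0∞} (hf : Measurable f) :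
    ∫⁻ v, ∫⁻ c, f (borderCoords s v c) =
      ENNReal.ofReal (symMatrix s).det * ∫⁻ t, ∫⁻ u, f (schurCoords s u t) := by
  have hdet : 0 < (symMatrix s).det := PosDef.det_pos hs
  rw [lintegral_comp_mulVec hdet.ne', abs_of_pos hdet,
    lintegral_lintegral_swap (f := fun t u => f (schurCoords s u t))
      (hf.comp ((measurable_schurCoords s).comp measurable_swap)).aemeasurable]
  congr 1
  exact lintegral_congr fun u =>
    (lintegral_add_right_eq_self (fun c => f (borderCoords s (symMatrix s *ᵥ u) c)) _).symm

theorem setLIntegral_posDefCone_succ {f : (Sym2 (Fin (P + 1)) → ℝ) → ℝ≥0∞} (hf : Measurable f) :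
    ∫⁻ x in posDefCone (P + 1), f x = ∫⁻ s in posDefCone P,
      ENNReal.ofReal (symMatrix s).det * ∫⁻ t in Set.Ioi 0, ∫⁻ u, f (schurCoords s u t) := by
  have hfi := hf.indicator (measurableSet_posDefCone (P + 1))
  rw [← lintegral_indicator (measurableSet_posDefCone _), lintegral_sym2_succ hfi,
    ← lintegral_indicator (measurableSet_posDefCone _)]
  refine lintegral_congr fun s => ?_
  by_cases hs : s ∈ posDefCone P
  · rw [Set.indicator_of_mem hs, lintegral_borderCoords hs hfi,
      ← lintegral_indicator measurableSet_Ioi]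
    congr 2 with t
    by_cases ht : 0 < t
    · simp [Set.indicator_of_mem, schurCoords_mem_posDefCone, hs, ht]
    · simp [Set.indicator_of_notMem, schurCoords_mem_posDefCone, ht]
  · have hborder (v : Fin P → ℝ) (c : ℝ) : borderCoords s v c ∉ posDefCone (P + 1) := by
      intro (h : (symMatrix (borderCoords s v c)).PosDef)
      have hsub : (symMatrix (borderCoords s v c)).submatrix Fin.castSucc Fin.castSucc =
          symMatrix s := by
        ext i j
        exact borderCoords_sym2Succ s v c (Sum.inl s(i, j))
      have hS : (symMatrix s).PosDef := hsub ▸ h.submatrix (Fin.castSucc_injective P)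
      exact hs hS
    simp [hs, hborder]

end PosDefCone

/-! ### The inverse Wishart integral -/

section InvWishart

variable {P : ℕ}

lemma multiGamma_succ (P : ℕ) (a : ℝ) : multiGamma (P + 1) a =
    Real.pi ^ ((P : ℝ) / 2) * Real.Gamma a * multiGamma P (a - 1 / 2) := by
  have hexp : ((P + 1 : ℕ) : ℝ) * (((P + 1 : ℕ) : ℝ) - 1) / 4 =
      (P : ℝ) / 2 + (P : ℝ) * ((P : ℝ) - 1) / 4 := by
    push_cast
    ring
  have harg (j : Fin P) : a - ((j.succ : Fin (P + 1)) : ℝ) / 2 = a - 1 / 2 - (j : ℝ) / 2 := by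
    rw [Fin.val_succ]
    push_cast
    ring
  rw [multiGamma, multiGamma, hexp, Real.rpow_add Real.pi_pos, Fin.prod_univ_succ]
  simp_rw [harg]
  simp only [Fin.val_zero, Nat.cast_zero, zero_div, sub_zero]
  ring

lemma multiGamma_pos {a : ℝ} (ha : (P : ℝ) - 1 < 2 * a) : 0 < multiGamma P a := by
  refine mul_pos (Real.rpow_pos_of_pos Real.pi_pos _) (Finset.prod_pos fun j _ => ?_)
  have hj : (j : ℝ) + 1 ≤ P := by exact_mod_cast j.2
  exact Real.Gamma_pos_of_pos (by linarith)

/-- The unnormalized density at `Sig` of the inverse Wishart distribution with scale matrix `2 • A`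
and `2 * a` degrees of freedom. -/
def invWishart (a : ℝ) (A Sig : Matrix (Fin P) (Fin P) ℝ) : ℝ :=
  Sig.det ^ (-a - ((P : ℝ) + 1) / 2) * Real.exp (-(Sig⁻¹ * A).trace)

lemma measurable_inv_symMatrix (i j : Fin P) :
    Measurable fun s : Sym2 (Fin P) → ℝ => (symMatrix s)⁻¹ i j := by
  simp_rw [Matrix.inv_def, Ring.inverse_eq_inv', Matrix.smul_apply, smul_eq_mul]
  exact measurable_det_symMatrix.inv.mul
    (continuous_symMatrix.matrix_adjugate.matrix_elem i j).measurable

lemma measurable_invWishart (a : ℝ) {α : Type*} [MeasurableSpace α] {s : α → Sym2 (Fin P) → ℝ}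
    (hs : Measurable s) {A : α → Matrix (Fin P) (Fin P) ℝ}
    (hA : ∀ i j, Measurable fun x => A x i j) :
    Measurable fun x => invWishart a (A x) (symMatrix (s x)) := by
  have htrace : Measurable fun x => ((symMatrix (s x))⁻¹ * A x).trace := by
    simp_rw [trace, diag_apply, mul_apply]
    exact Finset.measurable_fun_sum _ fun i _ => Finset.measurable_fun_sum _ fun j _ =>
      ((measurable_inv_symMatrix i j).comp hs).mul (hA j i)
  exact ((measurable_det_symMatrix.comp hs).pow_const _).mul htrace.neg.exp

lemma invWishart_pos {Sig : Matrix (Fin P) (Fin P) ℝ} (hSig : Sig.PosDef) (a : ℝ)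
    (A : Matrix (Fin P) (Fin P) ℝ) : 0 < invWishart a A Sig :=
  mul_pos (Real.rpow_pos_of_pos hSig.det_pos _) (Real.exp_pos _)

lemma det_mul_invWishart {Sig : Matrix (Fin P) (Fin P) ℝ} (hSig : Sig.PosDef) (a : ℝ)
    (A : Matrix (Fin P) (Fin P) ℝ) :
    Sig.det * invWishart (a + 1) A Sig = invWishart a A Sig := by
  have hpow : Sig.det ^ (-a - ((P : ℝ) + 1) / 2) =
      Sig.det * Sig.det ^ (-(a + 1) - ((P : ℝ) + 1) / 2) := by
    rw [mul_comm, ← Real.rpow_add_one hSig.det_pos.ne']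
    ring_nf
  rw [invWishart, invWishart, hpow, mul_assoc]

lemma invWishart_schurCoords {s : Sym2 (Fin P) → ℝ} (hs : s ∈ posDefCone P) {t : ℝ} (ht : 0 < t)
    (a : ℝ) (u : Fin P → ℝ) (r : Sym2 (Fin P) → ℝ) (m : Fin P → ℝ) (δ : ℝ) :
    invWishart a (symMatrix (schurCoords r m δ)) (symMatrix (schurCoords s u t)) =
      invWishart (a + 1 / 2) (symMatrix r) (symMatrix s) *
        (t ^ (-a - ((P : ℝ) + 2) / 2) * Real.exp (-(δ / t))) *
          Real.exp (-((u - m) ⬝ᵥ ((t⁻¹ • symMatrix r) *ᵥ (u - m)))) := by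
  have hdet : 0 < (symMatrix s).det := PosDef.det_pos hs
  have hexp : -a - (((P + 1 : ℕ) : ℝ) + 1) / 2 = -a - ((P : ℝ) + 2) / 2 := by
    push_cast
    ring
  have hexp' : -(a + 1 / 2) - ((P : ℝ) + 1) / 2 = -a - ((P : ℝ) + 2) / 2 := by ring
  rw [invWishart, invWishart, det_symMatrix_schurCoords,
    trace_inv_symMatrix_schurCoords_mul hs ht, hexp, hexp', Real.mul_rpow hdet.le ht.le, neg_add,
    Real.exp_add, add_div δ, neg_add (δ / t), Real.exp_add, smul_mulVec, dotProduct_smul,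
    smul_eq_mul, inv_mul_eq_div]
  ring

lemma lintegral_invWishart_schurCoords {s r : Sym2 (Fin P) → ℝ} (hs : s ∈ posDefCone P)
    (hr : r ∈ posDefCone P) {t : ℝ} (ht : 0 < t) (a : ℝ) (m : Fin P → ℝ) (δ : ℝ) :
    ∫⁻ u, ENNReal.ofReal
        (invWishart a (symMatrix (schurCoords r m δ)) (symMatrix (schurCoords s u t))) =
      ENNReal.ofReal (invWishart (a + 1 / 2) (symMatrix r) (symMatrix s)) *
        ENNReal.ofReal (Real.pi ^ ((P : ℝ) / 2) * (symMatrix r).det ^ (-(1 : ℝ) / 2)) *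
          ENNReal.ofReal (t ^ (-a - 1) * Real.exp (-(δ / t))) := by
  have hR : (symMatrix r).PosDef := hr
  have hw := (invWishart_pos hs (a + 1 / 2) (symMatrix r)).le
  have hdet := hR.det_pos
  have hscale : (t⁻¹ • symMatrix r).det ^ (-(1 : ℝ) / 2) =
      t ^ ((P : ℝ) / 2) * (symMatrix r).det ^ (-(1 : ℝ) / 2) := by
    rw [det_smul, Fintype.card_fin, Real.mul_rpow (by positivity) hdet.le, inv_pow,
      Real.inv_rpow (by positivity), ← Real.rpow_neg (by positivity),
      ← Real.rpow_natCast_mul ht.le]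
    ring_nf
  have hpow : t ^ (-a - 1) = t ^ (-a - ((P : ℝ) + 2) / 2) * t ^ ((P : ℝ) / 2) := by
    rw [← Real.rpow_add ht]
    ring_nf
  simp_rw [invWishart_schurCoords hs ht a]
  simp_rw [ENNReal.ofReal_mul (show 0 ≤ invWishart (a + 1 / 2) (symMatrix r) (symMatrix s) *
    (t ^ (-a - ((P : ℝ) + 2) / 2) * Real.exp (-(δ / t))) by positivity)]
  rw [lintegral_const_mul' _ _ ENNReal.ofReal_ne_top,
    lintegral_exp_neg_quadratic (hR.smul (inv_pos.mpr ht)), ← ENNReal.ofReal_mul (by positivity),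
    ← ENNReal.ofReal_mul hw, ← ENNReal.ofReal_mul (by positivity), hscale, hpow, Fintype.card_fin]
  congr 1
  ring

lemma det_mul_lintegral_invWishart_schurCoords {s r : Sym2 (Fin P) → ℝ}
    (hs : s ∈ posDefCone P) (hr : r ∈ posDefCone P) {a δ : ℝ} (ha : 0 < a) (hδ : 0 < δ)
    (m : Fin P → ℝ) :
    ENNReal.ofReal (symMatrix s).det * ∫⁻ t in Set.Ioi 0, ∫⁻ u, ENNReal.ofReal
        (invWishart a (symMatrix (schurCoords r m δ)) (symMatrix (schurCoords s u t))) =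
      ENNReal.ofReal (invWishart (a - 1 / 2) (symMatrix r) (symMatrix s)) *
        ENNReal.ofReal (Real.pi ^ ((P : ℝ) / 2) * (symMatrix r).det ^ (-(1 : ℝ) / 2) *
          (Real.Gamma a * δ ^ (-a))) := by
  have hdet : 0 < (symMatrix r).det := PosDef.det_pos hr
  rw [setLIntegral_congr_fun measurableSet_Ioi fun t ht =>
      lintegral_invWishart_schurCoords hs hr ht a m δ,
    lintegral_const_mul' _ _ (by finiteness), lintegral_rpow_mul_exp_neg_div ha hδ, mul_assoc,
    ← ENNReal.ofReal_mul (by positivity), ← mul_assoc, ← ENNReal.ofReal_mul (PosDef.det_pos hs).le,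
    ← det_mul_invWishart hs (a - 1 / 2)]
  ring_nf

lemma posDefCone_zero : posDefCone 0 = Set.univ :=
  Set.eq_univ_of_forall fun s => by
    rw [posDefCone, Set.mem_ofPred_eq, Subsingleton.elim (symMatrix s) 1]
    exact PosDef.one

theorem lintegral_invWishart {a : ℝ} (ha : (P : ℝ) - 1 < 2 * a)
    {A : Matrix (Fin P) (Fin P) ℝ} (hA : A.PosDef) :
    ∫⁻ s in posDefCone P, ENNReal.ofReal (invWishart a A (symMatrix s)) =
      ENNReal.ofReal (multiGamma P a * A.det ^ (-a)) := by
  induction P generalizing a with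
  | zero =>
    rw [posDefCone_zero, Measure.restrict_univ]
    simp [invWishart, multiGamma, Matrix.trace, volume_pi]
  | succ P ih =>
    push_cast at ha
    have ha0 : 0 < a := by linarith [(Nat.cast_nonneg P : (0 : ℝ) ≤ P)]
    obtain ⟨x, rfl⟩ := exists_symMatrix_eq (transpose_eq_of_posDef hA)
    obtain ⟨r, m, δ, rfl⟩ := exists_schurCoords_eq hA
    obtain ⟨hr, hδ⟩ := schurCoords_mem_posDefCone.mp hA
    have hdet : 0 < (symMatrix r).det := PosDef.det_pos hr
    have hmeas : Measurable fun x : Sym2 (Fin (P + 1)) → ℝ =>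
        ENNReal.ofReal (invWishart a (symMatrix (schurCoords r m δ)) (symMatrix x)) :=
      (measurable_invWishart a measurable_id (A := fun _ => symMatrix (schurCoords r m δ))
        fun _ _ => measurable_const).ennreal_ofReal
    have hpow : (symMatrix r).det ^ (-a) =
        (symMatrix r).det ^ (-(a - 1 / 2)) * (symMatrix r).det ^ (-(1 : ℝ) / 2) := by
      rw [← Real.rpow_add hdet]
      ring_nf
    have hgamma : 0 < multiGamma P (a - 1 / 2) := multiGamma_pos (by linarith)
    rw [setLIntegral_posDefCone_succ hmeas,
      setLIntegral_congr_fun (measurableSet_posDefCone P) fun s hs =>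
        det_mul_lintegral_invWishart_schurCoords hs hr ha0 hδ m,
      lintegral_mul_const' _ _ ENNReal.ofReal_ne_top, ih (by linarith) hr,
      ← ENNReal.ofReal_mul (by positivity), det_symMatrix_schurCoords,
      Real.mul_rpow hdet.le hδ.le, multiGamma_succ, hpow]
    congr 1
    ring

end InvWishart

/-! ### The normal–inverse Wishart distribution and its matrix `t` marginal -/

section NormalInvWishart

variable {K P : ℕ}

/-- The scale matrix of `Σ` given `Θ` under a normal–inverse Wishart distribution with location `M`,
row precision `G` and scale `A`. -/
def condScale (M : Matrix (Fin K) (Fin P) ℝ) (G : Matrix (Fin K) (Fin K) ℝ)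
    (A : Matrix (Fin P) (Fin P) ℝ) (Th : Matrix (Fin K) (Fin P) ℝ) : Matrix (Fin P) (Fin P) ℝ :=
  A + (Th - M)ᵀ * G * (Th - M)

variable {M : Matrix (Fin K) (Fin P) ℝ} {G : Matrix (Fin K) (Fin K) ℝ}
  {A : Matrix (Fin P) (Fin P) ℝ}

lemma posDef_condScale (hG : G.PosSemidef) (hA : A.PosDef) (Th : Matrix (Fin K) (Fin P) ℝ) :
    (condScale M G A Th).PosDef := by
  refine hA.add_posSemidef ?_
  rw [← conjTranspose_eq_transpose_of_trivial]
  exact hG.conjTranspose_mul_mul_same (Th - M)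

lemma continuous_condScale_unvec (M : Matrix (Fin K) (Fin P) ℝ) (G : Matrix (Fin K) (Fin K) ℝ)
    (A : Matrix (Fin P) (Fin P) ℝ) :
    Continuous fun v : Fin P × Fin K → ℝ => condScale M G A (unvec v) := by
  have hunvec : Continuous fun v : Fin P × Fin K → ℝ => unvec v :=
    continuous_matrix fun k p => continuous_apply (p, k)
  have hsub : Continuous fun v : Fin P × Fin K → ℝ => unvec v - M := hunvec.sub continuous_const
  exact continuous_const.add ((hsub.matrix_transpose.matrix_mul continuous_const).matrix_mul hsub)

lemma invWishart_condScale (a : ℝ) (M : Matrix (Fin K) (Fin P) ℝ) (G : Matrix (Fin K) (Fin K) ℝ)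
    (A : Matrix (Fin P) (Fin P) ℝ) (Th : Matrix (Fin K) (Fin P) ℝ)
    (Sig : Matrix (Fin P) (Fin P) ℝ) :
    invWishart a (condScale M G A Th) Sig = invWishart a A Sig *
      Real.exp (-(Sig⁻¹ * ((Th - M)ᵀ * G * (Th - M))).trace) := by
  rw [invWishart, invWishart, condScale, Matrix.mul_add, trace_add, neg_add, Real.exp_add,
    mul_assoc]

open scoped Kronecker in
lemma trace_mul_eq_vec_dotProduct_kronecker {W : Matrix (Fin P) (Fin P) ℝ} (hW : Wᵀ = W)
    (G : Matrix (Fin K) (Fin K) ℝ) (T : Matrix (Fin K) (Fin P) ℝ) :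
    (W * (Tᵀ * G * T)).trace = T.vec ⬝ᵥ ((W ⊗ₖ G) *ᵥ T.vec) := by
  rw [kronecker_mulVec_vec, vec_dotProduct_vec, hW, trace_mul_comm]
  simp only [Matrix.mul_assoc]

open scoped Kronecker in
lemma lintegral_exp_neg_trace {Sig : Matrix (Fin P) (Fin P) ℝ} (hSig : Sig.PosDef)
    (hG : G.PosDef) (M : Matrix (Fin K) (Fin P) ℝ) :
    ∫⁻ v, ENNReal.ofReal (Real.exp (-(Sig⁻¹ * ((unvec v - M)ᵀ * G * (unvec v - M))).trace)) =
      ENNReal.ofReal (Real.pi ^ ((K : ℝ) * P / 2) * G.det ^ (-(P : ℝ) / 2) *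
        Sig.det ^ ((K : ℝ) / 2)) := by
  have hdet := hSig.det_pos
  have hdetG := hG.det_pos
  have hexponent (v : Fin P × Fin K → ℝ) :
      (Sig⁻¹ * ((unvec v - M)ᵀ * G * (unvec v - M))).trace =
        (v - M.vec) ⬝ᵥ ((Sig⁻¹ ⊗ₖ G) *ᵥ (v - M.vec)) :=
    trace_mul_eq_vec_dotProduct_kronecker (transpose_eq_of_posDef hSig.inv) G (unvec v - M)
  have hkron : (Sig⁻¹ ⊗ₖ G).det ^ (-(1 : ℝ) / 2) =
      G.det ^ (-(P : ℝ) / 2) * Sig.det ^ ((K : ℝ) / 2) := by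
    rw [det_kronecker, det_nonsing_inv, Ring.inverse_eq_inv', Fintype.card_fin, Fintype.card_fin,
      Real.mul_rpow (by positivity) (by positivity), inv_pow, Real.inv_rpow (by positivity),
      ← Real.rpow_neg (by positivity), ← Real.rpow_natCast_mul hdet.le,
      ← Real.rpow_natCast_mul hdetG.le, mul_comm]
    ring_nf
  simp_rw [hexponent]
  rw [lintegral_exp_neg_quadratic (hSig.inv.kronecker hG), hkron, Fintype.card_prod,
    Fintype.card_fin, Fintype.card_fin, Nat.cast_mul, mul_comm (P : ℝ), mul_assoc]

/-- The total mass of the normal–inverse Wishart kernel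
`(Θ, Σ) ↦ invWishart a (condScale M G A Θ) Σ`. -/
def normalInvWishartMass (a : ℝ) (G : Matrix (Fin K) (Fin K) ℝ) (A : Matrix (Fin P) (Fin P) ℝ) :
    ℝ :=
  Real.pi ^ ((K : ℝ) * P / 2) * G.det ^ (-(P : ℝ) / 2) *
    (multiGamma P (a - K / 2) * A.det ^ (-(a - (K : ℝ) / 2)))

lemma normalInvWishartMass_pos (hG : G.PosDef) (hA : A.PosDef) {a : ℝ}
    (ha : (K : ℝ) + P - 1 < 2 * a) : 0 < normalInvWishartMass a G A := by
  have hdetG := hG.det_pos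
  have hdetA := hA.det_pos
  have hgamma : 0 < multiGamma P (a - K / 2) := multiGamma_pos (by linarith)
  rw [normalInvWishartMass]
  positivity

lemma lintegral_invWishart_condScale_unvec (hG : G.PosDef) (M : Matrix (Fin K) (Fin P) ℝ) (a : ℝ)
    (A : Matrix (Fin P) (Fin P) ℝ) {Sig : Matrix (Fin P) (Fin P) ℝ} (hSig : Sig.PosDef) :
    ∫⁻ v, ENNReal.ofReal (invWishart a (condScale M G A (unvec v)) Sig) =
      ENNReal.ofReal (Real.pi ^ ((K : ℝ) * P / 2) * G.det ^ (-(P : ℝ) / 2)) *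
        ENNReal.ofReal (invWishart (a - K / 2) A Sig) := by
  have hdetG := hG.det_pos
  have hw := (invWishart_pos hSig a A).le
  have hpow : Sig.det ^ (-(a - (K : ℝ) / 2) - ((P : ℝ) + 1) / 2) =
      Sig.det ^ ((K : ℝ) / 2) * Sig.det ^ (-a - ((P : ℝ) + 1) / 2) := by
    rw [← Real.rpow_add hSig.det_pos]
    ring_nf
  simp_rw [invWishart_condScale, ENNReal.ofReal_mul hw]
  rw [lintegral_const_mul' _ _ ENNReal.ofReal_ne_top, lintegral_exp_neg_trace hSig hG,
    ← ENNReal.ofReal_mul hw, ← ENNReal.ofReal_mul (by positivity)]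
  congr 1
  rw [invWishart, invWishart, hpow]
  ring

theorem lintegral_lintegral_invWishart_condScale (hG : G.PosDef) (hA : A.PosDef) {a : ℝ}
    (ha : (K : ℝ) + P - 1 < 2 * a) (M : Matrix (Fin K) (Fin P) ℝ) :
    ∫⁻ s in posDefCone P, ∫⁻ v,
        ENNReal.ofReal (invWishart a (condScale M G A (unvec v)) (symMatrix s)) =
      ENNReal.ofReal (normalInvWishartMass a G A) := by
  have hdetG := hG.det_pos
  rw [setLIntegral_congr_fun (measurableSet_posDefCone P) fun s hs =>
      lintegral_invWishart_condScale_unvec hG M a A hs,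
    lintegral_const_mul' _ _ ENNReal.ofReal_ne_top, lintegral_invWishart (by linarith) hA,
    ← ENNReal.ofReal_mul (by positivity), normalInvWishartMass]

lemma det_condScale (hA : A.PosDef) (M Th : Matrix (Fin K) (Fin P) ℝ)
    (G : Matrix (Fin K) (Fin K) ℝ) :
    (condScale M G A Th).det = A.det * (1 + A⁻¹ * (Th - M)ᵀ * G * (Th - M)).det := by
  rw [← det_mul, Matrix.mul_add, Matrix.mul_one, condScale]
  simp only [Matrix.mul_assoc]
  rw [mul_nonsing_inv_cancel_left _ _ hA.det_pos.ne'.isUnit]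

theorem matrixTDensity_eq_div (hG : G.PosDef) (hA : A.PosDef) (a : ℝ)
    (M Th : Matrix (Fin K) (Fin P) ℝ) :
    matrixTDensity M G⁻¹ A (2 * a - K - P + 1) Th =
      multiGamma P a * (condScale M G A Th).det ^ (-a) / normalInvWishartMass a G A := by
  have hdetG := hG.det_pos
  have hdetA := hA.det_pos
  have hdet := det_condScale hA M Th G
  rw [matrixTDensity, nonsing_inv_nonsing_inv _ hdetG.ne'.isUnit]
  set D := (1 + A⁻¹ * (Th - M)ᵀ * G * (Th - M)).det
  have hD : 0 < D := (mul_pos_iff_of_pos_left hdetA).mp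
    (hdet ▸ (posDef_condScale hG.posSemidef hA Th).det_pos)
  have hinv : (G⁻¹).det ^ (-(P : ℝ) / 2) = (G.det ^ (-(P : ℝ) / 2))⁻¹ := by
    rw [det_nonsing_inv, Ring.inverse_eq_inv', Real.inv_rpow hdetG.le]
  have hpow : A.det ^ (-a) = A.det ^ (-(a - K / 2)) * A.det ^ (-(K : ℝ) / 2) := by
    rw [← Real.rpow_add hdetA]
    ring_nf
  have hnu : (2 * a - K - P + 1 + K + P - 1) / 2 = a := by ring
  have hnu' : (2 * a - K - P + 1 + P - 1) / 2 = a - K / 2 := by ring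
  have hnu'' : -(2 * a - K - P + 1 + K + P - 1) / 2 = -a := by ring
  rw [normalInvWishartMass, hdet, hnu, hnu', hnu'', hinv, Real.mul_rpow hdetA.le hD.le, hpow]
  field_simp

lemma matrixTDensity_smul {c : ℝ} (hc : 0 < c) {Psi : Matrix (Fin K) (Fin K) ℝ}
    {Phi : Matrix (Fin P) (Fin P) ℝ} (hPsi : 0 < Psi.det) (hPhi : 0 < Phi.det)
    (M Th : Matrix (Fin K) (Fin P) ℝ) (nu : ℝ) :
    matrixTDensity M (c • Psi) (c⁻¹ • Phi) nu Th = matrixTDensity M Psi Phi nu Th := by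
  have hpow : (c ^ K) ^ (-(P : ℝ) / 2) * (c⁻¹ ^ P) ^ (-(K : ℝ) / 2) = 1 := by
    rw [inv_pow, Real.inv_rpow (by positivity), ← Real.rpow_neg (by positivity),
      ← Real.rpow_natCast_mul hc.le, ← Real.rpow_natCast_mul hc.le, ← Real.rpow_add hc]
    ring_nf
    exact Real.rpow_zero c
  have hquad : (c⁻¹ • Phi)⁻¹ * (Th - M)ᵀ * (c • Psi)⁻¹ * (Th - M) =
      Phi⁻¹ * (Th - M)ᵀ * Psi⁻¹ * (Th - M) := by
    have := invertibleOfNonzero hc.ne'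
    have := invertibleOfNonzero (inv_ne_zero hc.ne')
    rw [inv_smul _ _ hPsi.ne'.isUnit, inv_smul _ _ hPhi.ne'.isUnit, invOf_eq_inv, invOf_eq_inv,
      inv_inv]
    simp only [Matrix.smul_mul, Matrix.mul_smul, smul_smul, inv_mul_cancel₀ hc.ne', one_smul]
  have hdets : (c • Psi).det ^ (-(P : ℝ) / 2) * (c⁻¹ • Phi).det ^ (-(K : ℝ) / 2) =
      Psi.det ^ (-(P : ℝ) / 2) * Phi.det ^ (-(K : ℝ) / 2) := by
    rw [det_smul, det_smul, Fintype.card_fin, Fintype.card_fin,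
      Real.mul_rpow (by positivity) hPsi.le, Real.mul_rpow (by positivity) hPhi.le,
      mul_mul_mul_comm, hpow, one_mul]
  rw [matrixTDensity, matrixTDensity, hquad, mul_assoc (_ / _), hdets, ← mul_assoc]

end NormalInvWishart

section Model

variable {K P : ℕ}

/-- A likelihood whose product with the Jeffreys prior is `c` times a normal–inverse Wishart kernel
of finite mass, so that the posterior of `(Θ, Σ)` is normal–inverse Wishart, with location `M`,
row precision `G` and scale `A`. -/
structure IsNormalInvWishart (L : Matrix (Fin K) (Fin P) ℝ → Matrix (Fin P) (Fin P) ℝ → ℝ)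
    (c a : ℝ) (M : Matrix (Fin K) (Fin P) ℝ) (G : Matrix (Fin K) (Fin K) ℝ)
    (A : Matrix (Fin P) (Fin P) ℝ) : Prop where
  const_pos : 0 < c
  lt_two_mul : (K : ℝ) + P - 1 < 2 * a
  posDef_precision : G.PosDef
  posDef_scale : A.PosDef
  mul_jeffreys : ∀ Th Sig, Sig.PosDef →
    L Th Sig * jeffreys Sig = c * invWishart a (condScale M G A Th) Sig

variable {L : Matrix (Fin K) (Fin P) ℝ → Matrix (Fin P) (Fin P) ℝ → ℝ} {c a : ℝ}
  {M : Matrix (Fin K) (Fin P) ℝ} {G : Matrix (Fin K) (Fin K) ℝ} {A : Matrix (Fin P) (Fin P) ℝ}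

lemma euclideanHausdorffMeasure_mul_eq_volume :
    (Measure.euclideanHausdorffMeasure (P * K) :
      Measure (EuclideanSpace ℝ (Fin P × Fin K))) = volume := by
  rw [← InnerProductSpace.euclideanHausdorffMeasure_eq_volume, finrank_euclideanSpace,
    Fintype.card_prod, Fintype.card_fin, Fintype.card_fin]

lemma lintegral_euclideanHausdorffMeasure_mul (f : (Fin P × Fin K → ℝ) → ℝ≥0∞) :
    ∫⁻ θ : EuclideanSpace ℝ (Fin P × Fin K), f θ.ofLp
      ∂(Measure.euclideanHausdorffMeasure (P * K)) = ∫⁻ v, f v := by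
  rw [euclideanHausdorffMeasure_mul_eq_volume]
  exact (EuclideanSpace.volume_preserving_symm_measurableEquiv_toLp _).lintegral_comp_emb
    (MeasurableEquiv.measurableEmbedding _) f

namespace IsNormalInvWishart

lemma ofReal_mul_jeffreys (hL : IsNormalInvWishart L c a M G A) (Th : Matrix (Fin K) (Fin P) ℝ)
    {Sig : Matrix (Fin P) (Fin P) ℝ} (hSig : Sig.PosDef) :
    ENNReal.ofReal (L Th Sig * jeffreys Sig) =
      ENNReal.ofReal c * ENNReal.ofReal (invWishart a (condScale M G A Th) Sig) := by
  rw [hL.mul_jeffreys Th Sig hSig, ENNReal.ofReal_mul hL.const_pos.le]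

lemma evidence_eq (hL : IsNormalInvWishart L c a M G A) (d : ℕ)
    (S : Set (EuclideanSpace ℝ (Fin P × Fin K))) :
    evidence d S L = ENNReal.ofReal c * ∫⁻ s in posDefCone P, ∫⁻ θ in S,
      ENNReal.ofReal (invWishart a (condScale M G A (unvec θ.ofLp)) (symMatrix s))
        ∂(Measure.euclideanHausdorffMeasure d) := by
  rw [evidence, ← lintegral_const_mul' _ _ ENNReal.ofReal_ne_top]
  refine setLIntegral_congr_fun (measurableSet_posDefCone P) fun s hs => ?_
  simp only [hL.ofReal_mul_jeffreys _ hs]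
  exact lintegral_const_mul' _ _ ENNReal.ofReal_ne_top

theorem evidence_univ (hL : IsNormalInvWishart L c a M G A) :
    evidence (P * K) Set.univ L =
      ENNReal.ofReal c * ENNReal.ofReal (normalInvWishartMass a G A) := by
  rw [hL.evidence_eq, Measure.restrict_univ]
  simp_rw [fun s => lintegral_euclideanHausdorffMeasure_mul fun v =>
    ENNReal.ofReal (invWishart a (condScale M G A (unvec v)) (symMatrix s))]
  rw [lintegral_lintegral_invWishart_condScale hL.posDef_precision hL.posDef_scale hL.lt_two_mul]

lemma mass_pos (hL : IsNormalInvWishart L c a M G A) : 0 < normalInvWishartMass a G A :=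
  normalInvWishartMass_pos hL.posDef_precision hL.posDef_scale hL.lt_two_mul

lemma evidence_univ_mem_Ioo (hL : IsNormalInvWishart L c a M G A) :
    evidence (P * K) Set.univ L ∈ Set.Ioo 0 ⊤ := by
  rw [hL.evidence_univ]
  exact ⟨ENNReal.mul_pos (ENNReal.ofReal_pos.mpr hL.const_pos).ne'
    (ENNReal.ofReal_pos.mpr hL.mass_pos).ne', ENNReal.mul_lt_top ENNReal.ofReal_lt_top
    ENNReal.ofReal_lt_top⟩

lemma thetaDensity_mul_evidence (hL : IsNormalInvWishart L c a M G A)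
    (Th : Matrix (Fin K) (Fin P) ℝ) :
    thetaDensity L Th * evidence (P * K) Set.univ L = ENNReal.ofReal c * ∫⁻ s in posDefCone P,
      ENNReal.ofReal (invWishart a (condScale M G A Th) (symMatrix s)) := by
  have hev := hL.evidence_univ_mem_Ioo
  simp_rw [thetaDensity, div_eq_mul_inv]
  rw [lintegral_mul_const' _ _ (ENNReal.inv_ne_top.mpr hev.1.ne'), mul_assoc,
    ENNReal.inv_mul_cancel hev.1.ne' hev.2.ne, mul_one,
    ← lintegral_const_mul' _ _ ENNReal.ofReal_ne_top]
  exact setLIntegral_congr_fun (measurableSet_posDefCone P) fun s hs => hL.ofReal_mul_jeffreys Th hs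

theorem thetaDensity_eq (hL : IsNormalInvWishart L c a M G A) (Th : Matrix (Fin K) (Fin P) ℝ) :
    thetaDensity L Th = ENNReal.ofReal
      (multiGamma P a * (condScale M G A Th).det ^ (-a) / normalInvWishartMass a G A) := by
  have hev := hL.evidence_univ_mem_Ioo
  rw [← ENNReal.mul_left_inj hev.1.ne' hev.2.ne, hL.thetaDensity_mul_evidence,
    lintegral_invWishart (by linarith [hL.lt_two_mul, (K.cast_nonneg : (0 : ℝ) ≤ K)])
      (posDef_condScale hL.posDef_precision.posSemidef hL.posDef_scale Th),
    hL.evidence_univ, mul_left_comm, ← ENNReal.ofReal_mul' hL.mass_pos.le,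
    div_mul_cancel₀ _ hL.mass_pos.ne']

theorem thetaDensity_eq_matrixTDensity (hL : IsNormalInvWishart L c a M G A)
    (Th : Matrix (Fin K) (Fin P) ℝ) :
    thetaDensity L Th = ENNReal.ofReal (matrixTDensity M G⁻¹ A (2 * a - K - P + 1) Th) := by
  rw [hL.thetaDensity_eq, matrixTDensity_eq_div hL.posDef_precision hL.posDef_scale]

lemma measurable_thetaDensity_unvec (hL : IsNormalInvWishart L c a M G A) :
    Measurable fun v => thetaDensity L (unvec v) := by
  simp_rw [hL.thetaDensity_eq]
  exact (((continuous_condScale_unvec M G A).matrix_det.measurable.pow_const (-a)).const_mul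
    _).div_const _ |>.ennreal_ofReal

theorem evidence_eq_mul_setLIntegral (hL : IsNormalInvWishart L c a M G A) {d : ℕ}
    {S : Set (EuclideanSpace ℝ (Fin P × Fin K))}
    [SFinite ((Measure.euclideanHausdorffMeasure d).restrict S)] :
    evidence d S L = evidence (P * K) Set.univ L *
      ∫⁻ θ in S, thetaDensity L (unvec θ.ofLp) ∂(Measure.euclideanHausdorffMeasure d) := by
  have hmeas : Measurable fun x : (Sym2 (Fin P) → ℝ) × EuclideanSpace ℝ (Fin P × Fin K) =>
      ENNReal.ofReal (invWishart a (condScale M G A (unvec x.2.ofLp)) (symMatrix x.1)) :=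
    (measurable_invWishart a measurable_fst fun i j =>
      ((continuous_condScale_unvec M G A).matrix_elem i j).measurable.comp
        ((PiLp.continuous_ofLp 2 _).measurable.comp measurable_snd)).ennreal_ofReal
  rw [hL.evidence_eq, lintegral_lintegral_swap hmeas.aemeasurable,
    ← lintegral_const_mul' _ _ ENNReal.ofReal_ne_top,
    ← lintegral_const_mul' _ _ hL.evidence_univ_mem_Ioo.2.ne]
  simp_rw [← hL.thetaDensity_mul_evidence, mul_comm (evidence _ _ _)]

lemma lintegral_thetaDensity_unvec (hL : IsNormalInvWishart L c a M G A) :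
    ∫⁻ v, thetaDensity L (unvec v) = 1 := by
  have hev := hL.evidence_univ_mem_Ioo
  have : SFinite ((Measure.euclideanHausdorffMeasure (P * K) :
      Measure (EuclideanSpace ℝ (Fin P × Fin K))).restrict Set.univ) := by
    rw [euclideanHausdorffMeasure_mul_eq_volume]
    infer_instance
  rw [← ENNReal.mul_right_inj hev.1.ne' hev.2.ne, mul_one,
    ← lintegral_euclideanHausdorffMeasure_mul fun v => thetaDensity L (unvec v),
    ← setLIntegral_univ, ← hL.evidence_eq_mul_setLIntegral]

end IsNormalInvWishart

end Model

/-! ### Comparison of the density at translated points -/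

section Loewner

variable {n : Type*}

open scoped MatrixOrder in
lemma trace_mul_nonneg [Fintype n] {A B : Matrix n n ℝ} (hA : A.PosSemidef) (hB : B.PosSemidef) :
    0 ≤ (A * B).trace := by
  classical
  obtain ⟨C, rfl⟩ := CStarAlgebra.nonneg_iff_eq_star_mul_self.mp hA.nonneg
  rw [Matrix.mul_assoc, trace_mul_comm]
  exact (hB.mul_mul_conjTranspose_same C).trace_nonneg

open scoped MatrixOrder in
lemma exists_posSemidef_smul_one_sub [Finite n] [DecidableEq n] {Q : Matrix n n ℝ}
    (hQ : Q.IsHermitian) : ∃ r : ℝ, 0 < r ∧ (r • (1 : Matrix n n ℝ) - Q).PosSemidef := by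
  cases nonempty_fintype n
  obtain ⟨r, hr⟩ := (Matrix.finite_real_spectrum (A := Q)).bddAbove
  refine ⟨max r 1, by positivity, ?_⟩
  have hle := le_algebraMap_of_spectrum_le (fun x hx => (hr hx).trans (le_max_left r 1)) hQ
  rwa [Algebra.algebraMap_eq_smul_one] at hle

open scoped MatrixOrder in
lemma exists_posSemidef_smul_sub [Finite n] {A Q : Matrix n n ℝ} (hA : A.PosDef)
    (hQ : Q.IsHermitian) : ∃ r : ℝ, 0 < r ∧ (r • A - Q).PosSemidef := by
  classical
  cases nonempty_fintype n
  obtain ⟨C, hC⟩ := CStarAlgebra.nonneg_iff_eq_star_mul_self.mp hA.posSemidef.nonneg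
  have hunit : IsUnit C := by
    have hdet := hA.det_pos.ne'
    rw [hC, det_mul] at hdet
    exact (isUnit_iff_isUnit_det C).mpr (right_ne_zero_of_mul hdet).isUnit
  have hCC : C⁻¹ * C = 1 := nonsing_inv_mul C ((isUnit_iff_isUnit_det C).mp hunit)
  obtain ⟨r, hr, hle⟩ :=
    exists_posSemidef_smul_one_sub (isHermitian_conjTranspose_mul_mul C⁻¹ hQ)
  refine ⟨r, hr, ?_⟩
  have hconj : star C * (r • 1 - C⁻¹ᴴ * Q * C⁻¹) * C = r • A - Q := by
    have hstar : star C * C⁻¹ᴴ = 1 := by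
      rw [star_eq_conjTranspose, ← conjTranspose_mul, hCC, conjTranspose_one]
    calc star C * (r • 1 - C⁻¹ᴴ * Q * C⁻¹) * C
        = r • (star C * C) - star C * C⁻¹ᴴ * Q * (C⁻¹ * C) := by
          simp only [Matrix.mul_sub, Matrix.sub_mul, Matrix.mul_smul, Matrix.smul_mul,
            Matrix.mul_one, Matrix.mul_assoc]
      _ = r • A - Q := by rw [hstar, hCC, ← hC, Matrix.one_mul, Matrix.mul_one]
  rw [← hconj]
  exact (IsUnit.posSemidef_star_left_conjugate_iff hunit).mpr hle

end Loewner

section Harnack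

variable {K P : ℕ}

-- The inverse Wishart integral `Γ_P(a) |A| ^ (-a)` has an integrand that decreases in `A`.
lemma det_rpow_neg_anti {a : ℝ} (ha : (P : ℝ) - 1 < 2 * a) {A B : Matrix (Fin P) (Fin P) ℝ}
    (hA : A.PosDef) (hAB : (B - A).PosSemidef) : B.det ^ (-a) ≤ A.det ^ (-a) := by
  have hB : B.PosDef := by
    have hsum := hA.add_posSemidef hAB
    rwa [add_sub_cancel] at hsum
  have hdet := hA.det_pos
  have hgamma := multiGamma_pos ha
  have hlintegral : ∫⁻ s in posDefCone P, ENNReal.ofReal (invWishart a B (symMatrix s)) ≤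
      ∫⁻ s in posDefCone P, ENNReal.ofReal (invWishart a A (symMatrix s)) := by
    refine setLIntegral_mono' (measurableSet_posDefCone P) fun s hs => ENNReal.ofReal_le_ofReal ?_
    have hSig : (symMatrix s).PosDef := hs
    have hSig_det := hSig.det_pos
    have htrace := trace_mul_nonneg hSig.inv.posSemidef hAB
    rw [Matrix.mul_sub, trace_sub] at htrace
    rw [invWishart, invWishart]
    gcongr
    linarith
  rw [lintegral_invWishart ha hA, lintegral_invWishart ha hB,
    ENNReal.ofReal_le_ofReal_iff (by positivity)] at hlintegral
  exact le_of_mul_le_mul_left hlintegral hgamma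

variable {M : Matrix (Fin K) (Fin P) ℝ} {G : Matrix (Fin K) (Fin K) ℝ}
  {A : Matrix (Fin P) (Fin P) ℝ}

lemma exists_posSemidef_smul_condScale_sub (hG : G.PosSemidef) (hA : A.PosDef)
    (M Δ : Matrix (Fin K) (Fin P) ℝ) : ∃ r : ℝ, 0 < r ∧ ∀ Th,
      (r • condScale M G A Th - condScale M G A (Th + Δ)).PosSemidef := by
  have hquad (T : Matrix (Fin K) (Fin P) ℝ) : (Tᵀ * G * T).PosSemidef := by
    rw [← conjTranspose_eq_transpose_of_trivial]
    exact hG.conjTranspose_mul_mul_same T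
  obtain ⟨r, hr, hle⟩ :=
    exists_posSemidef_smul_sub hA ((hquad Δ).smul (zero_le_two (α := ℝ))).isHermitian
  refine ⟨r + 2, by positivity, fun Th => ?_⟩
  -- The parallelogram law for `T ↦ Tᵀ G T` at `Th - M ± Δ`.
  have hsplit : (r + 2) • condScale M G A Th - condScale M G A (Th + Δ) =
      (r • A - (2 : ℝ) • (Δᵀ * G * Δ)) + A + r • ((Th - M)ᵀ * G * (Th - M)) +
        (Th - M - Δ)ᵀ * G * (Th - M - Δ) := by
    rw [condScale, condScale, add_sub_right_comm]
    simp only [transpose_add, transpose_sub, Matrix.add_mul, Matrix.mul_add, Matrix.sub_mul,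
      Matrix.mul_sub]
    module
  rw [hsplit]
  exact ((hle.add hA.posSemidef).add ((hquad _).smul hr.le)).add (hquad _)

theorem IsNormalInvWishart.exists_thetaDensity_le
    {L : Matrix (Fin K) (Fin P) ℝ → Matrix (Fin P) (Fin P) ℝ → ℝ} {c a : ℝ}
    (hL : IsNormalInvWishart L c a M G A) (Δ : Matrix (Fin K) (Fin P) ℝ) :
    ∃ C : ℝ≥0∞, C ≠ ⊤ ∧ ∀ Th, thetaDensity L Th ≤ C * thetaDensity L (Th + Δ) := by
  have hG := hL.posDef_precision
  have hA := hL.posDef_scale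
  have hmass := hL.mass_pos
  have ha : (P : ℝ) - 1 < 2 * a := by linarith [hL.lt_two_mul, (K.cast_nonneg : (0 : ℝ) ≤ K)]
  have hgamma := multiGamma_pos ha
  obtain ⟨r, hr, hle⟩ := exists_posSemidef_smul_condScale_sub hG.posSemidef hA M Δ
  refine ⟨ENNReal.ofReal ((r ^ P) ^ a), ENNReal.ofReal_ne_top, fun Th => ?_⟩
  have hdet := (posDef_condScale hG.posSemidef hA (M := M) Th).det_pos
  have hanti : (condScale M G A Th).det ^ (-a) ≤
      (r ^ P) ^ a * (condScale M G A (Th + Δ)).det ^ (-a) := by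
    have hanti := det_rpow_neg_anti ha (posDef_condScale hG.posSemidef hA (Th + Δ)) (hle Th)
    rwa [det_smul, Fintype.card_fin, Real.mul_rpow (by positivity) hdet.le,
      Real.rpow_neg (by positivity), inv_mul_le_iff₀ (by positivity)] at hanti
  rw [hL.thetaDensity_eq, hL.thetaDensity_eq, ← ENNReal.ofReal_mul (by positivity),
    ← mul_div_assoc, mul_left_comm]
  gcongr

end Harnack

/-! ### Constrained spaces in the coordinates `ζ = (R_E θ, D θ)` -/

section Coordinates

variable {K P qE qO d : ℕ} {RE : Matrix (Fin qE) (Fin P × Fin K) ℝ}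
  {D : Matrix (Fin d) (Fin P × Fin K) ℝ} {e : Fin qE ⊕ Fin d ≃ Fin P × Fin K}

lemma coordMatrix_mulVec (v : Fin P × Fin K → ℝ) :
    coordMatrix RE D e *ᵥ v = Sum.elim (RE *ᵥ v) (D *ᵥ v) ∘ e.symm := by
  rw [← fromRows_mulVec]
  rfl

lemma thetaOf_mulVec (hH : IsUnit (coordMatrix RE D e).det) (v : Fin P × Fin K → ℝ) :
    thetaOf RE D e (RE *ᵥ v) (D *ᵥ v) = v := by
  rw [thetaOf, ← coordMatrix_mulVec, mulVec_mulVec, nonsing_inv_mul _ hH, one_mulVec]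

lemma mulVec_thetaOf (hH : IsUnit (coordMatrix RE D e).det) (zE : Fin qE → ℝ) (zO : Fin d → ℝ) :
    RE *ᵥ thetaOf RE D e zE zO = zE ∧ D *ᵥ thetaOf RE D e zE zO = zO := by
  have h : coordMatrix RE D e *ᵥ thetaOf RE D e zE zO = Sum.elim zE zO ∘ e.symm := by
    rw [thetaOf, mulVec_mulVec, mul_nonsing_inv _ hH, one_mulVec]
  rw [coordMatrix_mulVec] at h
  have helim := e.symm.surjective.injective_comp_right h
  exact ⟨congrArg (· ∘ Sum.inl) helim, congrArg (· ∘ Sum.inr) helim⟩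

lemma thetaOf_add (zE zE' : Fin qE → ℝ) (zO zO' : Fin d → ℝ) :
    thetaOf RE D e (zE + zE') (zO + zO') = thetaOf RE D e zE zO + thetaOf RE D e zE' zO' := by
  rw [thetaOf, thetaOf, thetaOf, ← mulVec_add]
  congr 1
  funext i
  rw [Pi.add_apply, Function.comp_apply, Function.comp_apply, Function.comp_apply]
  rcases e.symm i with j | j <;> rfl

lemma thetaOf_smul (r : ℝ) (zE : Fin qE → ℝ) (zO : Fin d → ℝ) :
    thetaOf RE D e (r • zE) (r • zO) = r • thetaOf RE D e zE zO := by
  rw [thetaOf, thetaOf, ← mulVec_smul]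
  congr 1
  funext i
  rw [Pi.smul_apply, Function.comp_apply, Function.comp_apply]
  rcases e.symm i with j | j <;> rfl

lemma thetaOf_add_mulVec (hH : IsUnit (coordMatrix RE D e).det) (zE : Fin qE → ℝ)
    (zO : Fin d → ℝ) (v : Fin P × Fin K → ℝ) :
    thetaOf RE D e (zE + RE *ᵥ v) (zO + D *ᵥ v) = thetaOf RE D e zE zO + v := by
  rw [thetaOf_add, thetaOf_mulVec hH]

lemma continuous_thetaOf :
    Continuous fun z : (Fin qE → ℝ) × (Fin d → ℝ) => thetaOf RE D e z.1 z.2 := by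
  refine Continuous.matrix_mulVec continuous_const (continuous_pi fun i => ?_)
  simp only [Function.comp_apply]
  rcases e.symm i with j | j
  · exact (continuous_apply j).comp continuous_fst
  · exact (continuous_apply j).comp continuous_snd

lemma continuous_thetaOf_right (zE : Fin qE → ℝ) : Continuous (thetaOf RE D e zE) :=
  continuous_thetaOf.comp (Continuous.prodMk_right zE)

variable (RE D e) in
/-- The linear map `ζ_O ↦ H⁻¹ (0, ζ_O)` between Euclidean spaces, a parametrization of the kernel
of `R_E`. Its `normDet` is the volume distortion of the coordinates `D θ`. -/
def freeMap : EuclideanSpace ℝ (Fin d) →ₗ[ℝ] EuclideanSpace ℝ (Fin P × Fin K) where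
  toFun z := WithLp.toLp 2 (thetaOf RE D e 0 z.ofLp)
  map_add' z w := by
    rw [WithLp.ofLp_add, ← WithLp.toLp_add, ← thetaOf_add, add_zero]
  map_smul' r z := by
    rw [RingHom.id_apply, WithLp.ofLp_smul, ← WithLp.toLp_smul, ← thetaOf_smul, smul_zero]

lemma freeMap_injective (hH : IsUnit (coordMatrix RE D e).det) :
    Function.Injective (freeMap RE D e) := by
  intro z w h
  have htheta : thetaOf RE D e 0 z.ofLp = thetaOf RE D e 0 w.ofLp := congrArg WithLp.ofLp h
  have hD := congrArg (D *ᵥ ·) htheta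
  simp only [(mulVec_thetaOf hH _ _).2] at hD
  exact WithLp.ofLp_injective 2 hD

lemma normDet_freeMap_pos (hH : IsUnit (coordMatrix RE D e).det) :
    0 < (freeMap RE D e).normDet :=
  (LinearMap.normDet_nonneg _).lt_of_ne' (((freeMap RE D e).normDet_ne_zero_tfae.out 0 1).mpr
    (LinearMap.ker_eq_bot.mpr (freeMap_injective hH)))

lemma euclideanHausdorffMeasure_image_thetaOf (zE : Fin qE → ℝ) (B : Set (Fin d → ℝ)) :
    Measure.euclideanHausdorffMeasure d
      ((fun zO => (WithLp.toLp 2 (thetaOf RE D e zE zO) : EuclideanSpace ℝ _)) '' B) =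
        ENNReal.ofReal (freeMap RE D e).normDet * volume B := by
  have himage : (fun zO => (WithLp.toLp 2 (thetaOf RE D e zE zO) : EuclideanSpace ℝ _)) '' B =
      (fun x => WithLp.toLp 2 (thetaOf RE D e zE 0) + x) ''
        (freeMap RE D e '' (WithLp.ofLp ⁻¹' B)) := by
    have htoLp : WithLp.ofLp ⁻¹' B = WithLp.toLp 2 '' B :=
      ((WithLp.equiv 2 (Fin d → ℝ)).symm.image_eq_preimage_symm B).symm
    rw [htoLp, Set.image_image, Set.image_image]
    refine Set.image_congr fun zO _ => ?_
    change _ = WithLp.toLp 2 (thetaOf RE D e zE 0) + WithLp.toLp 2 (thetaOf RE D e 0 zO)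
    rw [← WithLp.toLp_add, ← thetaOf_add, add_zero, zero_add]
  have hlinear := (freeMap RE D e).euclideanHausdorffMeasure_image_eq_normDet_mul_volume
    (WithLp.ofLp ⁻¹' B)
  rw [finrank_euclideanSpace, Fintype.card_fin] at hlinear
  rw [himage, (isometry_add_left _).euclideanHausdorffMeasure_image, hlinear]
  congr 1
  exact (EuclideanSpace.volume_preserving_symm_measurableEquiv_toLp _).measure_preimage_equiv B

variable {RO : Matrix (Fin qO) (Fin P × Fin K) ℝ} {rO : Fin qO → ℝ} {rE : Fin qE → ℝ}

variable (RE D e RO rO rE) in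
/-- The order constraints `R_O θ > r_O` in the coordinates `ζ_O = D θ` of `{θ | R_E θ = r_E}`. -/
def orderRegion : Set (Fin d → ℝ) :=
  {zO | ∀ i, rO i < (RO *ᵥ thetaOf RE D e rE zO) i}

lemma isOpen_orderRegion : IsOpen (orderRegion RE D e RO rO rE) := by
  rw [orderRegion, Set.ofPred_forall]
  exact isOpen_iInter_of_finite fun i => isOpen_lt continuous_const
    ((continuous_apply i).comp (continuous_const.matrix_mulVec (continuous_thetaOf_right rE)))

lemma image_orderRegion (hH : IsUnit (coordMatrix RE D e).det) :
    (fun zO => (WithLp.toLp 2 (thetaOf RE D e rE zO) : EuclideanSpace ℝ _)) ''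
      orderRegion RE D e RO rO rE = constrSet RE rE RO rO := by
  ext θ
  constructor
  · rintro ⟨zO, hzO, rfl⟩
    exact ⟨(mulVec_thetaOf hH rE zO).1, hzO⟩
  · rintro ⟨rfl, hO⟩
    refine ⟨D *ᵥ θ.ofLp, ?_, ?_⟩
    · rwa [orderRegion, Set.mem_ofPred_eq, thetaOf_mulVec hH]
    · simp only [thetaOf_mulVec hH, WithLp.toLp_ofLp]

lemma orderRegion_nonempty (hH : IsUnit (coordMatrix RE D e).det)
    (hM : (constrSet RE rE RO rO).Nonempty) : (orderRegion RE D e RO rO rE).Nonempty := by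
  rwa [← image_orderRegion hH, Set.image_nonempty] at hM

lemma restrict_constrSet (hH : IsUnit (coordMatrix RE D e).det) :
    (Measure.euclideanHausdorffMeasure d).restrict (constrSet RE rE RO rO) =
      ENNReal.ofReal (freeMap RE D e).normDet •
        (volume.restrict (orderRegion RE D e RO rO rE)).map
          fun zO => WithLp.toLp 2 (thetaOf RE D e rE zO) := by
  have hmeas : Measurable fun zO =>
      (WithLp.toLp 2 (thetaOf RE D e rE zO) : EuclideanSpace ℝ (Fin P × Fin K)) :=
    ((PiLp.continuous_toLp 2 _).comp (continuous_thetaOf_right rE)).measurable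
  ext A hA
  rw [Measure.restrict_apply hA, Measure.smul_apply, Measure.map_apply hmeas hA,
    Measure.restrict_apply (hmeas hA), smul_eq_mul,
    ← euclideanHausdorffMeasure_image_thetaOf rE, Set.image_preimage_inter, image_orderRegion hH]

lemma constrSet_nonempty_translate {v : Fin P × Fin K → ℝ}
    (hM : (constrSet RE (RE *ᵥ v) RO (RO *ᵥ v)).Nonempty) (w : Fin P × Fin K → ℝ) :
    (constrSet RE (RE *ᵥ w) RO (RO *ᵥ w)).Nonempty := by
  obtain ⟨θ, hE, hO⟩ := hM
  refine ⟨θ + WithLp.toLp 2 (w - v), ?_, fun i => ?_⟩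
  · rw [WithLp.ofLp_add, mulVec_add, mulVec_sub, hE, add_sub_cancel]
  · have := hO i
    rw [WithLp.ofLp_add, mulVec_add, mulVec_sub, Pi.add_apply, Pi.sub_apply]
    linarith

lemma adjConstrSet_eq_constrSet (C : Matrix (Fin K) (Fin P) ℝ) :
    adjConstrSet RE RO C = constrSet RE (RE *ᵥ C.vec) RO (RO *ᵥ C.vec) := by
  simp only [adjConstrSet, constrSet, mulVec_sub, sub_eq_zero, Pi.sub_apply, sub_pos]

lemma lintegral_eq_lintegral_thetaOf (hH : IsUnit (coordMatrix RE D e).det)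
    {f : (Fin P × Fin K → ℝ) → ℝ≥0∞} (hf : Measurable f) :
    ∫⁻ v, f v = ENNReal.ofReal |(coordMatrix RE D e).det|⁻¹ *
      ∫⁻ zE, ∫⁻ zO, f (thetaOf RE D e zE zO) := by
  have hdet : (coordMatrix RE D e)⁻¹.det = (coordMatrix RE D e).det⁻¹ := by
    rw [det_nonsing_inv, Ring.inverse_eq_inv']
  have hmeas : Measurable fun w => f ((coordMatrix RE D e)⁻¹ *ᵥ w) :=
    hf.comp (continuous_const.matrix_mulVec continuous_id).measurable
  rw [lintegral_comp_mulVec (M := (coordMatrix RE D e)⁻¹) (hdet ▸ inv_ne_zero hH.ne_zero), hdet,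
    abs_inv, lintegral_eq_lintegral_sumElim e hmeas]
  rfl

end Coordinates

/-! ### Marginal densities and conditional probabilities -/

section Slices

variable {K P qE qO d : ℕ} {RE : Matrix (Fin qE) (Fin P × Fin K) ℝ}
  {D : Matrix (Fin d) (Fin P × Fin K) ℝ} {e : Fin qE ⊕ Fin d ≃ Fin P × Fin K}
  {π : Matrix (Fin K) (Fin P) ℝ → ℝ≥0∞}

lemma zetaDensity_comp_add (hH : IsUnit (coordMatrix RE D e).det) (Δ : Matrix (Fin K) (Fin P) ℝ)
    (zE : Fin qE → ℝ) (zO : Fin d → ℝ) :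
    zetaDensity RE D e (fun Th => π (Th + Δ)) zE zO =
      zetaDensity RE D e π (zE + RE *ᵥ Δ.vec) (zO + D *ᵥ Δ.vec) := by
  rw [zetaDensity, zetaDensity, thetaOf_add_mulVec hH]
  rfl

lemma margDensity_comp_add (hH : IsUnit (coordMatrix RE D e).det) (Δ : Matrix (Fin K) (Fin P) ℝ)
    (zE : Fin qE → ℝ) :
    margDensity RE D e (fun Th => π (Th + Δ)) zE =
      margDensity RE D e π (zE + RE *ᵥ Δ.vec) := by
  simp_rw [margDensity, zetaDensity_comp_add hH]
  exact lintegral_add_right_eq_self _ _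

lemma condProb_comp_add (hH : IsUnit (coordMatrix RE D e).det) (Δ : Matrix (Fin K) (Fin P) ℝ)
    (RO : Matrix (Fin qO) (Fin P × Fin K) ℝ) (rO : Fin qO → ℝ) (zE : Fin qE → ℝ) :
    condProb RE D e RO rO (fun Th => π (Th + Δ)) zE =
      condProb RE D e RO (rO + RO *ᵥ Δ.vec) π (zE + RE *ᵥ Δ.vec) := by
  have hregion : orderRegion RE D e RO rO zE =
      (· + D *ᵥ Δ.vec) ⁻¹' orderRegion RE D e RO (rO + RO *ᵥ Δ.vec) (zE + RE *ᵥ Δ.vec) := by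
    simp only [orderRegion, Set.preimage_ofPred_eq, thetaOf_add_mulVec hH, mulVec_add,
      Pi.add_apply, add_lt_add_iff_right]
  simp_rw [condProb, zetaDensity_comp_add hH, margDensity_comp_add hH]
  change ∫⁻ zO in orderRegion RE D e RO rO zE, _ =
    ∫⁻ zO in orderRegion RE D e RO (rO + RO *ᵥ Δ.vec) (zE + RE *ᵥ Δ.vec), _
  rw [hregion]
  exact (measurePreserving_add_right volume (D *ᵥ Δ.vec)).setLIntegral_comp_preimage_emb
    (measurableEmbedding_addRight _)
    (fun zO => zetaDensity RE D e π (zE + RE *ᵥ Δ.vec) zO /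
      margDensity RE D e π (zE + RE *ᵥ Δ.vec)) _

lemma measurable_zetaDensity (hmeas : Measurable fun v => π (unvec v)) (zE : Fin qE → ℝ) :
    Measurable (zetaDensity RE D e π zE) :=
  (hmeas.comp (continuous_thetaOf_right zE).measurable).const_mul _

lemma zetaDensity_pos (hH : IsUnit (coordMatrix RE D e).det) (hpos : ∀ Th, 0 < π Th)
    (zE : Fin qE → ℝ) (zO : Fin d → ℝ) : 0 < zetaDensity RE D e π zE zO :=
  ENNReal.mul_pos (ENNReal.ofReal_pos.mpr (inv_pos.mpr (abs_pos.mpr hH.ne_zero))).ne'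
    (hpos _).ne'

lemma setLIntegral_zetaDensity_pos (hH : IsUnit (coordMatrix RE D e).det)
    (hmeas : Measurable fun v => π (unvec v)) (hpos : ∀ Th, 0 < π Th) (zE : Fin qE → ℝ)
    {U : Set (Fin d → ℝ)} (hU : IsOpen U) (hne : U.Nonempty) :
    0 < ∫⁻ zO in U, zetaDensity RE D e π zE zO := by
  rw [setLIntegral_pos_iff (measurable_zetaDensity hmeas zE),
    Set.eq_univ_of_forall (s := Function.support _) fun zO => (zetaDensity_pos hH hpos zE zO).ne',
    Set.univ_inter]
  exact hU.measure_pos volume hne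

lemma margDensity_pos (hH : IsUnit (coordMatrix RE D e).det)
    (hmeas : Measurable fun v => π (unvec v)) (hpos : ∀ Th, 0 < π Th) (zE : Fin qE → ℝ) :
    0 < margDensity RE D e π zE := by
  rw [margDensity, ← setLIntegral_univ]
  exact setLIntegral_zetaDensity_pos hH hmeas hpos zE isOpen_univ Set.univ_nonempty

lemma lintegral_margDensity (hH : IsUnit (coordMatrix RE D e).det)
    (hmeas : Measurable fun v => π (unvec v)) :
    ∫⁻ zE, margDensity RE D e π zE = ∫⁻ v, π (unvec v) := by
  simp_rw [margDensity, zetaDensity]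
  simp_rw [lintegral_const_mul' _ _ ENNReal.ofReal_ne_top]
  exact (lintegral_eq_lintegral_thetaOf hH hmeas).symm

/- By Fubini almost every slice of an integrable density has finite mass, and by `hle` the masses of
any two parallel slices are comparable. -/
lemma margDensity_lt_top (hH : IsUnit (coordMatrix RE D e).det)
    (hmeas : Measurable fun v => π (unvec v)) (hfin : ∫⁻ v, π (unvec v) ≠ ⊤)
    (hle : ∀ Δ, ∃ C : ℝ≥0∞, C ≠ ⊤ ∧ ∀ Th, π Th ≤ C * π (Th + Δ)) (zE : Fin qE → ℝ) :
    margDensity RE D e π zE < ⊤ := by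
  have hmeas_marg : Measurable fun z => margDensity RE D e π z :=
    ((hmeas.comp continuous_thetaOf.measurable).const_mul _).lintegral_prod_right'
  rw [← lintegral_margDensity hH hmeas] at hfin
  obtain ⟨zE', hzE'⟩ := (ae_lt_top hmeas_marg hfin).exists
  set Δ : Matrix (Fin K) (Fin P) ℝ := unvec (thetaOf RE D e (zE' - zE) 0)
  have hΔ : zE + RE *ᵥ Δ.vec = zE' := by
    have hvec : Δ.vec = thetaOf RE D e (zE' - zE) 0 := rfl
    rw [hvec, (mulVec_thetaOf hH _ _).1, add_sub_cancel]
  obtain ⟨C, hC, hle⟩ := hle Δ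
  calc margDensity RE D e π zE
      ≤ ∫⁻ zO, C * zetaDensity RE D e (fun Th => π (Th + Δ)) zE zO := by
        refine lintegral_mono fun zO => ?_
        rw [zetaDensity, zetaDensity, mul_left_comm]
        gcongr
        exact hle _
    _ = C * margDensity RE D e π zE' := by
        rw [lintegral_const_mul' _ _ hC, ← hΔ, ← margDensity_comp_add hH, margDensity]
    _ < ⊤ := ENNReal.mul_lt_top hC.lt_top hzE'

variable {RO : Matrix (Fin qO) (Fin P × Fin K) ℝ} {rO : Fin qO → ℝ} {rE : Fin qE → ℝ}

lemma condProb_eq (hmarg : margDensity RE D e π rE ≠ 0) :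
    condProb RE D e RO rO π rE =
      (∫⁻ zO in orderRegion RE D e RO rO rE, zetaDensity RE D e π rE zO) /
        margDensity RE D e π rE := by
  simp_rw [condProb, div_eq_mul_inv]
  exact lintegral_mul_const' _ _ (ENNReal.inv_ne_top.mpr hmarg)

lemma condProb_le_one (hmarg : margDensity RE D e π rE ≠ 0) :
    condProb RE D e RO rO π rE ≤ 1 := by
  rw [condProb_eq hmarg]
  refine ENNReal.div_le_of_le_mul ?_
  rw [one_mul]
  exact setLIntegral_le_lintegral _ _

lemma margDensity_mul_condProb (hmarg : margDensity RE D e π rE ∈ Set.Ioo 0 ⊤) :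
    margDensity RE D e π rE * condProb RE D e RO rO π rE =
      ∫⁻ zO in orderRegion RE D e RO rO rE, zetaDensity RE D e π rE zO := by
  rw [condProb_eq hmarg.1.ne', ENNReal.mul_div_cancel hmarg.1.ne' hmarg.2.ne]

lemma condProb_pos (hH : IsUnit (coordMatrix RE D e).det)
    (hmeas : Measurable fun v => π (unvec v)) (hpos : ∀ Th, 0 < π Th)
    (hmarg : margDensity RE D e π rE ∈ Set.Ioo 0 ⊤) (hM : (constrSet RE rE RO rO).Nonempty) :
    0 < condProb RE D e RO rO π rE := by
  rw [condProb_eq hmarg.1.ne']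
  exact ENNReal.div_pos (setLIntegral_zetaDensity_pos hH hmeas hpos rE isOpen_orderRegion
    (orderRegion_nonempty hH hM)).ne' hmarg.2.ne

end Slices

/-! ### The Bayes factor -/

namespace IsNormalInvWishart

variable {K P qE qO d : ℕ} {L : Matrix (Fin K) (Fin P) ℝ → Matrix (Fin P) (Fin P) ℝ → ℝ}
  {c a : ℝ} {M : Matrix (Fin K) (Fin P) ℝ} {G : Matrix (Fin K) (Fin K) ℝ}
  {A : Matrix (Fin P) (Fin P) ℝ} {RE : Matrix (Fin qE) (Fin P × Fin K) ℝ} {rE : Fin qE → ℝ}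
  {RO : Matrix (Fin qO) (Fin P × Fin K) ℝ} {rO : Fin qO → ℝ}
  {D : Matrix (Fin d) (Fin P × Fin K) ℝ} {e : Fin qE ⊕ Fin d ≃ Fin P × Fin K}

lemma thetaDensity_pos (hL : IsNormalInvWishart L c a M G A) (Th : Matrix (Fin K) (Fin P) ℝ) :
    0 < thetaDensity L Th := by
  have hgamma : 0 < multiGamma P a :=
    multiGamma_pos (by linarith [hL.lt_two_mul, (K.cast_nonneg : (0 : ℝ) ≤ K)])
  have hdet :=
    (posDef_condScale hL.posDef_precision.posSemidef hL.posDef_scale (M := M) Th).det_pos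
  have hmass := hL.mass_pos
  rw [hL.thetaDensity_eq, ENNReal.ofReal_pos]
  positivity

lemma margDensity_mem_Ioo (hL : IsNormalInvWishart L c a M G A)
    (hH : IsUnit (coordMatrix RE D e).det) (zE : Fin qE → ℝ) :
    margDensity RE D e (thetaDensity L) zE ∈ Set.Ioo 0 ⊤ := by
  have hmeas := hL.measurable_thetaDensity_unvec
  have hfin : ∫⁻ v, thetaDensity L (unvec v) ≠ ⊤ := by
    rw [hL.lintegral_thetaDensity_unvec]
    exact ENNReal.one_ne_top
  exact ⟨margDensity_pos hH hmeas hL.thetaDensity_pos zE,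
    margDensity_lt_top hH hmeas hfin hL.exists_thetaDensity_le zE⟩

lemma condProb_mem_Ioc (hL : IsNormalInvWishart L c a M G A)
    (hH : IsUnit (coordMatrix RE D e).det) (hM : (constrSet RE rE RO rO).Nonempty) :
    condProb RE D e RO rO (thetaDensity L) rE ∈ Set.Ioc 0 1 :=
  have hmarg := hL.margDensity_mem_Ioo hH rE
  ⟨condProb_pos hH hL.measurable_thetaDensity_unvec hL.thetaDensity_pos hmarg hM,
    condProb_le_one hmarg.1.ne'⟩

theorem evidence_constrSet (hL : IsNormalInvWishart L c a M G A)
    (hH : IsUnit (coordMatrix RE D e).det) :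
    evidence (P * K - qE) (constrSet RE rE RO rO) L =
      ENNReal.ofReal ((freeMap RE D e).normDet * |(coordMatrix RE D e).det|) *
        (evidence (P * K) Set.univ L * (margDensity RE D e (thetaDensity L) rE *
          condProb RE D e RO rO (thetaDensity L) rE)) := by
  have hd : P * K - qE = d := by
    have hcard := Fintype.card_congr e
    simp only [Fintype.card_sum, Fintype.card_fin, Fintype.card_prod] at hcard
    omega
  have : SFinite ((Measure.euclideanHausdorffMeasure d).restrict (constrSet RE rE RO rO)) := by
    rw [restrict_constrSet hH]
    infer_instance
  have hparam : Measurable fun zO =>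
      (WithLp.toLp 2 (thetaOf RE D e rE zO) : EuclideanSpace ℝ (Fin P × Fin K)) :=
    ((PiLp.continuous_toLp 2 _).comp (continuous_thetaOf_right rE)).measurable
  have hmeas : Measurable fun θ : EuclideanSpace ℝ (Fin P × Fin K) =>
      thetaDensity L (unvec θ.ofLp) :=
    hL.measurable_thetaDensity_unvec.comp (PiLp.continuous_ofLp 2 _).measurable
  have hdet : |(coordMatrix RE D e).det| ≠ 0 := abs_ne_zero.mpr hH.ne_zero
  have hnormDet := normDet_freeMap_pos hH
  rw [hd, hL.evidence_eq_mul_setLIntegral, restrict_constrSet hH, lintegral_smul_measure,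
    lintegral_map hmeas hparam, margDensity_mul_condProb (hL.margDensity_mem_Ioo hH rE)]
  simp_rw [zetaDensity]
  rw [lintegral_const_mul' _ _ ENNReal.ofReal_ne_top, smul_eq_mul, mul_left_comm (evidence _ _ _),
    mul_left_comm (evidence _ _ _), ← mul_assoc (ENNReal.ofReal (_ * _)),
    ← ENNReal.ofReal_mul (by positivity), mul_inv_cancel_right₀ hdet]

lemma evidence_constrSet_mem_Ioo (hL : IsNormalInvWishart L c a M G A)
    (hH : IsUnit (coordMatrix RE D e).det) (hM : (constrSet RE rE RO rO).Nonempty) :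
    evidence (P * K - qE) (constrSet RE rE RO rO) L ∈ Set.Ioo 0 ⊤ := by
  have hev := hL.evidence_univ_mem_Ioo
  have hmarg := hL.margDensity_mem_Ioo hH rE
  have hcond := hL.condProb_mem_Ioc hH hM
  rw [hL.evidence_constrSet hH, Set.mem_Ioo]
  refine ⟨ENNReal.mul_pos ?_ ?_, ENNReal.mul_lt_top ENNReal.ofReal_lt_top
    (ENNReal.mul_lt_top hev.2 (ENNReal.mul_lt_top hmarg.2
      (hcond.2.trans_lt ENNReal.one_lt_top)))⟩
  · exact (ENNReal.ofReal_pos.mpr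
      (mul_pos (normDet_freeMap_pos hH) (abs_pos.mpr hH.ne_zero))).ne'
  · exact mul_ne_zero hev.1.ne' (mul_ne_zero hmarg.1.ne' hcond.1.ne')

variable {L' : Matrix (Fin K) (Fin P) ℝ → Matrix (Fin P) (Fin P) ℝ → ℝ}
  {c' a' : ℝ} {M' : Matrix (Fin K) (Fin P) ℝ} {G' : Matrix (Fin K) (Fin K) ℝ}
  {A' : Matrix (Fin P) (Fin P) ℝ}

theorem evidence_constrSet_div_div (hL : IsNormalInvWishart L c a M G A)
    (hL' : IsNormalInvWishart L' c' a' M' G' A') (hH : IsUnit (coordMatrix RE D e).det)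
    (rE rE' : Fin qE → ℝ) (RO : Matrix (Fin qO) (Fin P × Fin K) ℝ) (rO rO' : Fin qO → ℝ) :
    evidence (P * K - qE) (constrSet RE rE RO rO) L /
        evidence (P * K - qE) (constrSet RE rE' RO rO') L' /
          (evidence (P * K) Set.univ L / evidence (P * K) Set.univ L') =
      margDensity RE D e (thetaDensity L) rE / margDensity RE D e (thetaDensity L') rE' *
        (condProb RE D e RO rO (thetaDensity L) rE /
          condProb RE D e RO rO' (thetaDensity L') rE') := by
  have hev := hL.evidence_univ_mem_Ioo
  have hev' := hL'.evidence_univ_mem_Ioo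
  have hmarg' := hL'.margDensity_mem_Ioo hH rE'
  have hfactor : ENNReal.ofReal ((freeMap RE D e).normDet * |(coordMatrix RE D e).det|) ≠ 0 :=
    (ENNReal.ofReal_pos.mpr (mul_pos (normDet_freeMap_pos hH) (abs_pos.mpr hH.ne_zero))).ne'
  rw [hL.evidence_constrSet hH, hL'.evidence_constrSet hH,
    ENNReal.mul_div_mul_left _ _ hfactor ENNReal.ofReal_ne_top,
    ENNReal.mul_div_mul_comm (.inl hev'.1.ne') (.inl hev'.2.ne),
    ENNReal.mul_div_mul_comm (.inl hmarg'.1.ne') (.inl hmarg'.2.ne), mul_comm (_ / _) (_ * _)]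
  exact ENNReal.mul_div_cancel_right (ENNReal.div_pos hev.1.ne' hev'.2.ne).ne'
    (ENNReal.div_lt_top hev.2.ne hev'.1.ne').ne

end IsNormalInvWishart

/-! ### Least squares -/

section LeastSquares

variable {N K P : ℕ} {b : Fin N → ℝ} {X : Matrix (Fin N) (Fin K) ℝ}

lemma injective_mulVec_of_rank_eq (hX : X.rank = K) : Function.Injective X.mulVec := by
  rw [mulVec_injective_iff, linearIndependent_iff_card_eq_finrank_span, Fintype.card_fin,
    Set.finrank, ← rank_eq_finrank_span_cols, hX]

lemma posDef_transpose_mul_self (hX : Function.Injective X.mulVec) : (Xᵀ * X).PosDef := by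
  simpa only [conjTranspose_eq_transpose_of_trivial] using PosDef.conjTranspose_mul_self X hX

lemma fracRows_eq_mul (b : Fin N → ℝ) (X : Matrix (Fin N) (Fin K) ℝ) :
    fracRows b X = diagonal (fun i => √(b i)) * X := by
  ext i j
  rw [fracRows, of_apply, diagonal_mul]

lemma fracRows_one (X : Matrix (Fin N) (Fin K) ℝ) : fracRows (fun _ => 1) X = X := by
  rw [fracRows_eq_mul, Real.sqrt_one, diagonal_one, Matrix.one_mul]

lemma injective_mulVec_of_fromCols {Y : Matrix (Fin N) (Fin P) ℝ}
    (h : Function.Injective (fromCols X Y).mulVec) : Function.Injective X.mulVec := by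
  intro v w hvw
  have hsum : Sum.elim v (0 : Fin P → ℝ) = Sum.elim w 0 := h (by
    simpa only [fromCols_mulVec_sumElim, mulVec_zero, add_zero] using hvw)
  exact (Sum.elim_eq_iff.mp hsum).1

lemma injective_fromCols_fracRows (hb : ∀ i, 0 < b i) {Y : Matrix (Fin N) (Fin P) ℝ}
    (h : Function.Injective (fromCols X Y).mulVec) :
    Function.Injective (fromCols (fracRows b X) (fracRows b Y)).mulVec := by
  have hdiag : Function.Injective (diagonal fun i => √(b i)).mulVec :=
    mulVec_injective_of_det_ne_zero (by
      rw [det_diagonal]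
      exact Finset.prod_ne_zero_iff.mpr fun i _ => (Real.sqrt_pos.mpr (hb i)).ne')
  rw [fracRows_eq_mul, fracRows_eq_mul, ← mul_fromCols]
  intro v w hvw
  simp only [← mulVec_mulVec] at hvw
  exact h (hdiag hvw)

lemma transpose_mul_residual (hX : (Xᵀ * X).PosDef) (Y : Matrix (Fin N) (Fin P) ℝ) :
    Xᵀ * (Y - X * lsEst Y X) = 0 := by
  rw [Matrix.mul_sub, lsEst, ← Matrix.mul_assoc, ← Matrix.mul_assoc, ← Matrix.mul_assoc,
    mul_nonsing_inv _ hX.det_pos.ne'.isUnit, Matrix.one_mul, sub_self]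

lemma residual_transpose_mul (hX : (Xᵀ * X).PosDef) (Y : Matrix (Fin N) (Fin P) ℝ) :
    (Y - X * lsEst Y X)ᵀ * X = 0 := by
  simpa only [transpose_mul, transpose_transpose, transpose_zero] using
    congrArg transpose (transpose_mul_residual hX Y)

lemma posDef_sumSq {Y : Matrix (Fin N) (Fin P) ℝ}
    (h : Function.Injective (fromCols X Y).mulVec) : (sumSq Y X).PosDef := by
  refine posDef_transpose_mul_self fun v w hvw => ?_
  have hsum : Sum.elim (-(lsEst Y X *ᵥ v)) v = Sum.elim (-(lsEst Y X *ᵥ w)) w := h (by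
    simpa only [fromCols_mulVec_sumElim, sub_mulVec, ← mulVec_mulVec, mulVec_neg,
      neg_add_eq_sub] using hvw)
  exact (Sum.elim_eq_iff.mp hsum).2

lemma injective_fromCols_of_posDef_sumSq {Y : Matrix (Fin N) (Fin P) ℝ}
    (hX : (Xᵀ * X).PosDef) (hS : (sumSq Y X).PosDef) :
    Function.Injective (fromCols X Y).mulVec := by
  refine (injective_iff_map_eq_zero (fromCols X Y).mulVecLin).mpr fun v hv => ?_
  obtain ⟨y, z, rfl⟩ : ∃ y z, v = Sum.elim y z := ⟨_, _, (Sum.elim_comp_inl_inr v).symm⟩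
  rw [mulVecLin_apply, fromCols_mulVec_sumElim] at hv
  have hz : z = 0 := by
    refine mulVec_injective_of_det_ne_zero hS.det_pos.ne' ?_
    have hres := congrArg ((Y - X * lsEst Y X)ᵀ *ᵥ ·) hv
    simp only [mulVec_add, mulVec_mulVec, residual_transpose_mul hX, zero_mulVec, zero_add,
      mulVec_zero] at hres
    rw [sumSq, Matrix.mul_sub, ← Matrix.mul_assoc, residual_transpose_mul hX, Matrix.zero_mul,
      sub_zero, hres, mulVec_zero]
  have hy : y = 0 := by
    refine mulVec_injective_of_det_ne_zero hX.det_pos.ne' ?_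
    rw [hz, mulVec_zero, add_zero] at hv
    rw [← mulVec_mulVec, hv, mulVec_zero, mulVec_zero]
  rw [hy, hz, Sum.elim_zero_zero]

lemma add_le_of_injective_fromCols {Y : Matrix (Fin N) (Fin P) ℝ}
    (h : Function.Injective (fromCols X Y).mulVec) : K + P ≤ N := by
  simpa only [Module.finrank_fintype_fun_eq_card, Fintype.card_sum, Fintype.card_fin] using
    LinearMap.finrank_le_finrank_of_injective (f := (fromCols X Y).mulVecLin) h

lemma transpose_mul_self_eq_condScale (hX : (Xᵀ * X).PosDef)
    (Y : Matrix (Fin N) (Fin P) ℝ) (Th : Matrix (Fin K) (Fin P) ℝ) :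
    (Y - X * Th)ᵀ * (Y - X * Th) = condScale (lsEst Y X) (Xᵀ * X) (sumSq Y X) Th := by
  have hsplit : Y - X * Th = (Y - X * lsEst Y X) - X * (Th - lsEst Y X) := by
    rw [Matrix.mul_sub, sub_sub, add_sub_cancel]
  have hXR := transpose_mul_residual hX Y
  have hRX := residual_transpose_mul hX Y
  rw [condScale, sumSq, hsplit]
  generalize Y - X * lsEst Y X = R at hXR hRX ⊢
  generalize Th - lsEst Y X = T
  rw [transpose_sub, transpose_mul, Matrix.sub_mul, Matrix.mul_sub, Matrix.mul_sub,
    ← Matrix.mul_assoc Rᵀ, hRX, Matrix.mul_assoc Tᵀ Xᵀ R, hXR, Matrix.zero_mul, Matrix.mul_zero,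
    sub_zero, zero_sub, sub_neg_eq_add, Matrix.mul_assoc, Matrix.mul_assoc, Matrix.mul_assoc]

end LeastSquares

/-! ### The fractional likelihood -/

section Likelihood

variable {N K P : ℕ} {b : Fin N → ℝ}

lemma sum_mul_quadratic_eq_trace (hb : ∀ i, 0 ≤ b i) (Y : Matrix (Fin N) (Fin P) ℝ)
    (X : Matrix (Fin N) (Fin K) ℝ) (Th : Matrix (Fin K) (Fin P) ℝ)
    (W : Matrix (Fin P) (Fin P) ℝ) :
    ∑ i, b i * ((Y i - Thᵀ *ᵥ X i) ⬝ᵥ (W *ᵥ (Y i - Thᵀ *ᵥ X i))) =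
      (W * ((fracRows b Y - fracRows b X * Th)ᵀ * (fracRows b Y - fracRows b X * Th))).trace := by
  set R := fracRows b Y - fracRows b X * Th with hR
  have hrow (i : Fin N) : R i = √(b i) • (Y i - Thᵀ *ᵥ X i) := by
    ext j
    rw [hR, fracRows_eq_mul, fracRows_eq_mul, Matrix.mul_assoc, ← Matrix.mul_sub,
      diagonal_mul, Pi.smul_apply, smul_eq_mul, Pi.sub_apply, mulVec_transpose]
    rfl
  have hdiag (i : Fin N) : (R * (W * Rᵀ)) i i = R i ⬝ᵥ (W *ᵥ R i) := rfl
  rw [← Matrix.mul_assoc, trace_mul_comm, trace]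
  refine Finset.sum_congr rfl fun i _ => ?_
  rw [diag_apply, hdiag, hrow, mulVec_smul, dotProduct_smul, smul_dotProduct, smul_eq_mul,
    smul_eq_mul, ← mul_assoc, Real.mul_self_sqrt (hb i)]

lemma gaussDensity_rpow {Sig : Matrix (Fin P) (Fin P) ℝ} (hSig : 0 < Sig.det) (m y : Fin P → ℝ)
    (t : ℝ) :
    gaussDensity m Sig y ^ t =
      (2 * Real.pi) ^ (-(P : ℝ) / 2 * t) * Sig.det ^ (-(1 : ℝ) / 2 * t) *
        Real.exp (-(1 / 2) * (t * ((y - m) ⬝ᵥ (Sig⁻¹ *ᵥ (y - m))))) := by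
  rw [gaussDensity, Real.mul_rpow (by positivity) (by positivity),
    Real.mul_rpow (by positivity) (by positivity), ← Real.rpow_mul (by positivity),
    ← Real.rpow_mul hSig.le, ← Real.exp_mul]
  ring_nf

lemma fracLikelihood_mul_jeffreys (hb : ∀ i, 0 ≤ b i) (Y : Matrix (Fin N) (Fin P) ℝ)
    (X : Matrix (Fin N) (Fin K) ℝ) (Th : Matrix (Fin K) (Fin P) ℝ)
    {Sig : Matrix (Fin P) (Fin P) ℝ} (hSig : 0 < Sig.det) :
    fracLikelihood b Y X Th Sig * jeffreys Sig = (2 * Real.pi) ^ (-(P : ℝ) / 2 * ∑ i, b i) *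
      invWishart ((∑ i, b i) / 2) ((2⁻¹ : ℝ) •
        ((fracRows b Y - fracRows b X * Th)ᵀ * (fracRows b Y - fracRows b X * Th))) Sig := by
  have hexponent : Sig.det ^ (-((∑ i, b i) / 2) - ((P : ℝ) + 1) / 2) =
      Sig.det ^ (-(1 : ℝ) / 2 * ∑ i, b i) * Sig.det ^ (-((P : ℝ) + 1) / 2) := by
    rw [← Real.rpow_add hSig]
    ring_nf
  simp_rw [fracLikelihood, gaussDensity_rpow hSig]
  rw [jeffreys, invWishart, Finset.prod_mul_distrib, Finset.prod_mul_distrib,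
    ← Real.rpow_sum_of_pos (by positivity),
    ← Real.rpow_sum_of_pos hSig, ← Real.exp_sum, ← Finset.mul_sum, ← Finset.mul_sum,
    ← Finset.mul_sum, sum_mul_quadratic_eq_trace hb, Matrix.mul_smul, trace_smul, smul_eq_mul,
    hexponent, one_div, neg_mul]
  ring

lemma fracLikelihood_one (Y : Matrix (Fin N) (Fin P) ℝ) (X : Matrix (Fin N) (Fin K) ℝ) :
    fracLikelihood (fun _ => 1) Y X = likelihood Y X := by
  ext Th Sig
  simp only [fracLikelihood, likelihood, Real.rpow_one]

theorem isNormalInvWishart_fracLikelihood (hb : ∀ i, 0 ≤ b i) {Y : Matrix (Fin N) (Fin P) ℝ}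
    {X : Matrix (Fin N) (Fin K) ℝ} (hX : ((fracRows b X)ᵀ * fracRows b X).PosDef)
    (hS : (sumSq (fracRows b Y) (fracRows b X)).PosDef)
    (hdf : 0 < (∑ i, b i) - (K : ℝ) - (P : ℝ) + 1) :
    IsNormalInvWishart (fracLikelihood b Y X) ((2 * Real.pi) ^ (-(P : ℝ) / 2 * ∑ i, b i))
      ((∑ i, b i) / 2) (lsEst (fracRows b Y) (fracRows b X))
      ((2⁻¹ : ℝ) • ((fracRows b X)ᵀ * fracRows b X))
      ((2⁻¹ : ℝ) • sumSq (fracRows b Y) (fracRows b X)) where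
  const_pos := by positivity
  lt_two_mul := by linarith
  posDef_precision := hX.smul (by norm_num)
  posDef_scale := hS.smul (by norm_num)
  mul_jeffreys Th Sig hSig := by
    rw [fracLikelihood_mul_jeffreys hb Y X Th hSig.det_pos, transpose_mul_self_eq_condScale hX]
    simp only [condScale, smul_add, Matrix.mul_smul, Matrix.smul_mul]

theorem isNormalInvWishart_likelihood {Y : Matrix (Fin N) (Fin P) ℝ}
    {X : Matrix (Fin N) (Fin K) ℝ} (hX : (Xᵀ * X).PosDef) (hS : (sumSq Y X).PosDef) :
    IsNormalInvWishart (likelihood Y X) ((2 * Real.pi) ^ (-(P : ℝ) / 2 * N)) ((N : ℝ) / 2)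
      (lsEst Y X) ((2⁻¹ : ℝ) • (Xᵀ * X)) ((2⁻¹ : ℝ) • sumSq Y X) := by
  have hsum : ∑ _i : Fin N, (1 : ℝ) = N := by
    rw [Finset.sum_const, Finset.card_univ, Fintype.card_fin, nsmul_one]
  have hKP : (K : ℝ) + P ≤ N := by
    exact_mod_cast add_le_of_injective_fromCols (injective_fromCols_of_posDef_sumSq hX hS)
  have h := isNormalInvWishart_fracLikelihood (b := fun _ => 1) (Y := Y) (X := X)
    (fun _ => zero_le_one) (by rwa [fracRows_one]) (by rwa [fracRows_one, fracRows_one])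
    (by rw [hsum]; linarith)
  rwa [fracRows_one, fracRows_one, hsum, fracLikelihood_one] at h

lemma IsNormalInvWishart.thetaDensity_eq_of_half {c n : ℝ} {M : Matrix (Fin K) (Fin P) ℝ}
    {L : Matrix (Fin K) (Fin P) ℝ → Matrix (Fin P) (Fin P) ℝ → ℝ}
    {G : Matrix (Fin K) (Fin K) ℝ} {S : Matrix (Fin P) (Fin P) ℝ}
    (hL : IsNormalInvWishart L c (n / 2) M ((2⁻¹ : ℝ) • G) ((2⁻¹ : ℝ) • S))
    (Th : Matrix (Fin K) (Fin P) ℝ) :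
    thetaDensity L Th = ENNReal.ofReal (matrixTDensity M G⁻¹ S (n - K - P + 1) Th) := by
  have hinv : G⁻¹ = (2⁻¹ : ℝ) • ((2⁻¹ : ℝ) • G)⁻¹ :=
    inv_eq_left_inv (by
      rw [Matrix.smul_mul, ← Matrix.mul_smul,
        nonsing_inv_mul _ hL.posDef_precision.det_pos.ne'.isUnit])
  have hscale : S = (2⁻¹ : ℝ)⁻¹ • (2⁻¹ : ℝ) • S := (inv_smul_smul₀ (by norm_num) S).symm
  rw [hL.thetaDensity_eq_matrixTDensity, mul_div_cancel₀ n two_ne_zero,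
    ← matrixTDensity_smul (inv_pos.mpr two_pos) hL.posDef_precision.inv.det_pos
      hL.posDef_scale.det_pos, ← hinv, ← hscale]

end Likelihood

/-! ### Posterior and default prior -/

section DefaultPrior

variable {N K P : ℕ} {b : Fin N → ℝ} {Y : Matrix (Fin N) (Fin P) ℝ} {X : Matrix (Fin N) (Fin K) ℝ}

theorem posterior_eq_matrixTDensity (hX : (Xᵀ * X).PosDef) (hS : (sumSq Y X).PosDef)
    (Th : Matrix (Fin K) (Fin P) ℝ) :
    posterior Y X Th = ENNReal.ofReal
      (matrixTDensity (lsEst Y X) (Xᵀ * X)⁻¹ (sumSq Y X) ((N : ℝ) - K - P + 1) Th) :=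
  (isNormalInvWishart_likelihood hX hS).thetaDensity_eq_of_half Th

lemma defaultPrior_eq (b : Fin N → ℝ) (Th0 : Matrix (Fin K) (Fin P) ℝ) :
    defaultPrior Y X b Th0 = fun Th => thetaDensity (fracLikelihood b Y X)
      (Th + (lsEst (fracRows b Y) (fracRows b X) - Th0)) := by
  simp_rw [← add_sub_assoc]
  rfl

theorem defaultPrior_eq_matrixTDensity (hb : ∀ i, 0 ≤ b i)
    (hX : ((fracRows b X)ᵀ * fracRows b X).PosDef)
    (hS : (sumSq (fracRows b Y) (fracRows b X)).PosDef)
    (hdf : 0 < (∑ i, b i) - (K : ℝ) - (P : ℝ) + 1) (Th0 Th : Matrix (Fin K) (Fin P) ℝ) :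
    defaultPrior Y X b Th0 Th = ENNReal.ofReal
      (matrixTDensity Th0 ((fracRows b X)ᵀ * fracRows b X)⁻¹
        (sumSq (fracRows b Y) (fracRows b X)) ((∑ i, b i) - (K : ℝ) - (P : ℝ) + 1) Th) := by
  have hloc : Th + (lsEst (fracRows b Y) (fracRows b X) - Th0) -
      lsEst (fracRows b Y) (fracRows b X) = Th - Th0 := by abel
  rw [congrFun (defaultPrior_eq b Th0) Th,
    (isNormalInvWishart_fracLikelihood hb hX hS hdf).thetaDensity_eq_of_half,
    matrixTDensity, hloc, ← matrixTDensity]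

variable {qE qO d : ℕ} {RE : Matrix (Fin qE) (Fin P × Fin K) ℝ}
  {D : Matrix (Fin d) (Fin P × Fin K) ℝ} {e : Fin qE ⊕ Fin d ≃ Fin P × Fin K}

lemma margDensity_defaultPrior (hH : IsUnit (coordMatrix RE D e).det)
    (Th0 : Matrix (Fin K) (Fin P) ℝ) :
    margDensity RE D e (defaultPrior Y X b Th0) (RE *ᵥ Th0.vec) =
      margDensity RE D e (thetaDensity (fracLikelihood b Y X))
        (RE *ᵥ (lsEst (fracRows b Y) (fracRows b X)).vec) := by
  rw [defaultPrior_eq, margDensity_comp_add hH, ← mulVec_add, ← vec_add, add_sub_cancel]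

lemma condProb_defaultPrior (hH : IsUnit (coordMatrix RE D e).det)
    (RO : Matrix (Fin qO) (Fin P × Fin K) ℝ) (Th0 : Matrix (Fin K) (Fin P) ℝ) :
    condProb RE D e RO (RO *ᵥ Th0.vec) (defaultPrior Y X b Th0) (RE *ᵥ Th0.vec) =
      condProb RE D e RO (RO *ᵥ (lsEst (fracRows b Y) (fracRows b X)).vec)
        (thetaDensity (fracLikelihood b Y X))
        (RE *ᵥ (lsEst (fracRows b Y) (fracRows b X)).vec) := by
  rw [defaultPrior_eq, condProb_comp_add hH, ← mulVec_add, ← mulVec_add, ← vec_add, add_sub_cancel]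

end DefaultPrior

end MVLM

end

theorem lemma1 {N K P qE qO d : ℕ}
    -- data and fractions
    (Y : Matrix (Fin N) (Fin P) ℝ) (X : Matrix (Fin N) (Fin K) ℝ) (b : Fin N → ℝ)
    (hb : ∀ i, 0 < b i)
    (hX : X.rank = K) (hS : (MVLM.sumSq Y X).PosDef)
    (hdf : 0 < (∑ i, b i) - (K : ℝ) - (P : ℝ) + 1)
    -- constraints
    (RE : Matrix (Fin qE) (Fin P × Fin K) ℝ) (rE : Fin qE → ℝ)
    (RO : Matrix (Fin qO) (Fin P × Fin K) ℝ) (rO : Fin qO → ℝ)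
    (hM : (MVLM.constrSet RE rE RO rO).Nonempty)
    (Th0 : Matrix (Fin K) (Fin P) ℝ)
    (h0E : RE *ᵥ Th0.vec = rE) (h0O : RO *ᵥ Th0.vec = rO)
    -- coordinates `ζ = (R_E θ, D θ)` completing `R_E θ`
    (D : Matrix (Fin d) (Fin P × Fin K) ℝ) (e : Fin qE ⊕ Fin d ≃ Fin P × Fin K)
    (hH : IsUnit (MVLM.coordMatrix RE D e).det) :
    let Yb := MVLM.fracRows b Y
    let Xb := MVLM.fracRows b X
    let post := MVLM.posterior Y X
    let prior := MVLM.defaultPrior Y X b Th0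
    let fE := MVLM.margDensity RE D e post rE
    let cE := MVLM.margDensity RE D e prior rE
    let fO := MVLM.condProb RE D e RO rO post rE
    let cO := MVLM.condProb RE D e RO rO prior rE
    -- the integrals that define the Bayes factor are positive and finite
    (MVLM.evidence (P * K - qE) (MVLM.constrSet RE rE RO rO) (MVLM.likelihood Y X)
        ∈ Set.Ioo 0 ⊤ ∧
      MVLM.evidence (P * K - qE) (MVLM.adjConstrSet RE RO (MVLM.lsEst Yb Xb))
        (MVLM.fracLikelihood b Y X) ∈ Set.Ioo 0 ⊤ ∧
      MVLM.evidence (P * K) Set.univ (MVLM.likelihood Y X) ∈ Set.Ioo 0 ⊤ ∧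
      MVLM.evidence (P * K) Set.univ (MVLM.fracLikelihood b Y X) ∈ Set.Ioo 0 ⊤) ∧
    -- so are the densities, and the conditional probabilities lie in `(0, 1]`
    (fE ∈ Set.Ioo 0 ⊤ ∧ cE ∈ Set.Ioo 0 ⊤ ∧ fO ∈ Set.Ioc 0 1 ∧ cO ∈ Set.Ioc 0 1) ∧
    -- factorization of the Bayes factor
    MVLM.bayesFactor Y X b RE rE RO rO = fE / cE * (fO / cO) ∧
    -- the posterior and the default prior of `Θ` are matrix `t`
    (∀ Th, post Th = ENNReal.ofReal (MVLM.matrixTDensity (MVLM.lsEst Y X) (Xᵀ * X)⁻¹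
      (MVLM.sumSq Y X) ((N : ℝ) - K - P + 1) Th)) ∧
    (∀ Th, prior Th = ENNReal.ofReal (MVLM.matrixTDensity Th0 (Xbᵀ * Xb)⁻¹
      (MVLM.sumSq Yb Xb) ((∑ i, b i) - (K : ℝ) - (P : ℝ) + 1) Th)) := by
  subst h0E h0O
  intro Yb Xb post prior fE cE fO cO
  have hX' := MVLM.posDef_transpose_mul_self (MVLM.injective_mulVec_of_rank_eq hX)
  have hXY := MVLM.injective_fromCols_fracRows hb (MVLM.injective_fromCols_of_posDef_sumSq hX' hS)
  have hXb := MVLM.posDef_transpose_mul_self (MVLM.injective_mulVec_of_fromCols hXY)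
  have hSb := MVLM.posDef_sumSq hXY
  have hb' (i : Fin N) : 0 ≤ b i := (hb i).le
  have hL := MVLM.isNormalInvWishart_likelihood hX' hS
  have hLb := MVLM.isNormalInvWishart_fracLikelihood hb' hXb hSb hdf
  have hMb := MVLM.constrSet_nonempty_translate hM (MVLM.lsEst Yb Xb).vec
  have hcE : cE = _ := MVLM.margDensity_defaultPrior hH Th0
  have hcO : cO = _ := MVLM.condProb_defaultPrior hH RO Th0
  rw [MVLM.bayesFactor, MVLM.constrMargLik, MVLM.uncMargLik, MVLM.adjConstrSet_eq_constrSet, hcE,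
    hcO]
  exact ⟨⟨hL.evidence_constrSet_mem_Ioo hH hM, hLb.evidence_constrSet_mem_Ioo hH hMb,
      hL.evidence_univ_mem_Ioo, hLb.evidence_univ_mem_Ioo⟩,
    ⟨hL.margDensity_mem_Ioo hH _, hLb.margDensity_mem_Ioo hH _, hL.condProb_mem_Ioc hH hM,
      hLb.condProb_mem_Ioc hH hMb⟩,
    hL.evidence_constrSet_div_div hLb hH _ _ _ _ _,
    MVLM.posterior_eq_matrixTDensity hX' hS,
    MVLM.defaultPrior_eq_matrixTDensity hb' hXb hSb hdf Th0⟩
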